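/- **Setting.** Vectors are in Euclidean 3-space, $|\cdot|$ is the Euclidean norm, and time runs over $[0,\infty)$. An aircraft of mass $m>0$ has position $\boldsymbol p$, velocity $\boldsymbol v=\dot{\boldsymbol p}$, acceleration $\boldsymbol a=\dot{\boldsymbol v}$, and a right-handed orthonormal body frame $\mathcal B=(\boldsymbol\imath,\boldsymbol\jmath,\boldsymbol k)$ with angular velocity $\boldsymbol\omega$ (so $\dot{\boldsymbol\imath}=\boldsymbol\omega\times\boldsymbol\imath$, etc.). Let $\boldsymbol g=g_0\boldsymbol k_0$ be gravity ($g_0>0$, $\boldsymbol k_0$ a fixed unit vector), $\boldsymbol v_w$ the wind velocity (bounded, differentiable in time), $\boldsymbol v_a=\boldsymbol v-\boldsymbol v_w$ the air-velocity with coordinates $v_{a,1},v_{a,2},v_{a,3}$ in $\mathcal B$, and $\beta=\arctan(v_{a,2}/v_{a,1})$ the sideslip angle. Let $c_0,c_1>0$, $\bar c_0=c_0+2c_1$. The motion satisfies $m\boldsymbol a=m\boldsymbol g+\boldsymbol F_a+T\boldsymbol\imath$ with $$\boldsymbol F_a=-(c_0v_{a,1}\boldsymbol\imath+\bar c_0v_{a,3}\boldsymbol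 k)|\boldsymbol v_a|+v_{a,2}\boldsymbol O(\boldsymbol v_a),$$ where $\boldsymbol O$ is a vector-valued function (it may depend on the body frame) with $|\boldsymbol O(\boldsymbol v_a)|/|\boldsymbol v_a|$ bounded. The controls are the thrust $T$ and $\boldsymbol\omega$. Put $\boldsymbol h=\boldsymbol v/|\boldsymbol v|$ and $\bar{\boldsymbol g}=\boldsymbol g-\frac{\bar c_0}{m}|\boldsymbol v_a|\boldsymbol v_a$. For $\Delta>0$ let $\alpha^\Delta:[0,\infty)\to(0,1]$ be a strictly decreasing, twice differentiable function with $\alpha^\Delta(0)=1$, $(\alpha^\Delta)'(0)=0$, $\alpha^\Delta(x)\le\Delta/x$ for $x>0$, $x\alpha^\Delta(x)\to\Delta$ as $x\to\infty$, the family being jointly continuous in $(\Delta,x)$; put $\overline{\mathrm{sat}}^\Delta(y)=\alpha^\Delta(|y|)y$. **Thrust control.** Let $v^*(t)>0$ be the desired speed (differentiable, bounded, with bounded derivative), $e_v=|\boldsymbol v|-v^*$. Set $T=\bar T-2c_1v_{a,1}|\boldsymbol v_a|$ with $$\bar T=\frac{m\big(-\bar{\boldsymbol g}\cdot\boldsymbol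 h+\dot v^*-k_{T,1}e_v-k_{T,2}\,\alpha^{\Delta_e}(|I+e_v/k_{T,3}|)\,I\big)}{\boldsymbol\imath\cdot\boldsymbol h},\qquad \dot I=k_{T,2}k_{T,3}\big(-I+\overline{\mathrm{sat}}^{\Delta_e}(I+e_v/k_{T,3})\big),$$ where $k_{T,1}=k_{T,11}+k_{T,12}|e_v|^p$ with constants $k_{T,11},k_{T,12}>0$, $p>1$, $k_{T,2}>0$ is a function of $e_v$ with $k_{T,1}/k_{T,2}$ bounded above and away from $0$, and $k_{T,3},\Delta_e>0$ are constants. **Attitude control.** Let $\boldsymbol h^*(t)$ be the desired heading, a differentiable unit vector; $\boldsymbol\omega_{h^*}=\boldsymbol h^*\times\dot{\boldsymbol h}^*$, $\tilde{\boldsymbol h}=\boldsymbol h\times\boldsymbol h^*$. With positive constants $k_{h,1},k_{h,2},k_z,\Delta_z$ and $\alpha_h=\alpha^{\Delta_z}(|\boldsymbol z+\tilde{\boldsymbol h}/k_z|)$, $$\dot{\boldsymbol z}=\boldsymbol\omega_{h^*}\times\boldsymbol z+k_z\big(-\boldsymbol z+\overline{\mathrm{sat}}^{\Delta_z}(\boldsymbol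 z+\tilde{\boldsymbol h}/k_z)\big),\quad \boldsymbol z(0)=\boldsymbol 0,$$ $$\bar{\boldsymbol\omega}_h=\boldsymbol\omega_{h^*}+k_{h,1}\tilde{\boldsymbol h}+k_{h,2}\alpha_h\boldsymbol z,\qquad \boldsymbol a^*=\dot v^*\boldsymbol h+|\boldsymbol v|\,\bar{\boldsymbol\omega}_h\times\boldsymbol h .$$ The desired frame $\bar{\mathcal B}=(\bar{\boldsymbol\imath},\bar{\boldsymbol\jmath},\bar{\boldsymbol k})$, assumed differentiable in time, is $\bar{\boldsymbol\imath}=\frac{\boldsymbol a^*-\bar{\boldsymbol g}}{|\boldsymbol a^*-\bar{\boldsymbol g}|}$, $\bar{\boldsymbol\jmath}=\frac{\boldsymbol v_a\times\bar{\boldsymbol\imath}}{|\boldsymbol v_a\times\bar{\boldsymbol\imath}|}$, $\bar{\boldsymbol k}=\bar{\boldsymbol\imath}\times\bar{\boldsymbol\jmath}$; its angular velocity is $\bar{\boldsymbol\omega}=\bar{\boldsymbol\imath}\times\dot{\bar{\boldsymbol\imath}}+\big(\bar{\boldsymbol\imath}\cdot(\bar{\boldsymbol\jmath}\times\dot{\bar{\boldsymbol\jmath}})\big)\bar{\boldsymbol\imath}$,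 and the control is $$\boldsymbol\omega=\bar{\boldsymbol\omega}+k_\omega(t)\big(\boldsymbol\imath\times\bar{\boldsymbol\imath}+\boldsymbol\jmath\times\bar{\boldsymbol\jmath}+\boldsymbol k\times\bar{\boldsymbol k}\big),\qquad k_\omega(t)>\epsilon>0 .$$ Let $\tilde\theta\in[0,\pi]$ be the angle of the rotation between $\mathcal B$ and $\bar{\mathcal B}$, given by $1+2\cos\tilde\theta=\boldsymbol\imath\cdot\bar{\boldsymbol\imath}+\boldsymbol\jmath\cdot\bar{\boldsymbol\jmath}+\boldsymbol k\cdot\bar{\boldsymbol k}$. **Path and guidance.** The path is a three times differentiable curve $\boldsymbol q(s)$ parametrized by arc length, with unit tangent $\boldsymbol u$ and a parallel transport frame $(\boldsymbol u,\bar{\boldsymbol u},\bar{\bar{\boldsymbol u}})$: $\boldsymbol u'=\gamma_1\bar{\boldsymbol u}+\gamma_2\bar{\bar{\boldsymbol u}}$, $\bar{\boldsymbol u}'=-\gamma_1\boldsymbol u$, $\bar{\bar{\boldsymbol u}}'=-\gamma_2\boldsymbol u$, with $\gamma_1,\gamma_2$ bounded. Let $\boldsymbol q(s(t))$ be the (locally)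 closest point of the path to the aircraft, $s(t)$ being differentiable, $\tilde{\boldsymbol p}=\boldsymbol p-\boldsymbol q(s)$ the path error, and $y=(y_1,y_2)=(\tilde{\boldsymbol p}\cdot\bar{\boldsymbol u},\tilde{\boldsymbol p}\cdot\bar{\bar{\boldsymbol u}})$. The guidance law is $$\boldsymbol h^*=\sin(\theta_h)\,\boldsymbol l+\cos(\theta_h)\,\sigma\,\boldsymbol u,\quad \bar y=\frac{k_1D\,\overline{\mathrm{sat}}^{\Delta_h}(y)}{|\boldsymbol v|},\quad \theta_h=\arctan\frac{|\bar y|}{\sqrt{1-|\bar y|^2}},\quad \boldsymbol l=-\frac{\bar y_1\bar{\boldsymbol u}+\bar y_2\bar{\bar{\boldsymbol u}}}{|\bar y|},\tag{G}$$ with $\sigma\in\{1,-1\}$ chosen in advance, $D=\mathrm{diag}(d_1,d_2)$, $d_i\in(0,1]$, $k_1>0$, $\mu\in(0,1)$, $\Delta_h=\mu|\boldsymbol v|/(k_1\max(d_1,d_2))$. **Theorem.** Consider a solution on $[0,\infty)$ of this closed-loop system, and assume that for all $t\ge 0$ the quantities $1-\gamma_1y_1-\gamma_2y_2$, $|\boldsymbol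 v|$, $|\boldsymbol a-\bar{\boldsymbol g}|$, $|\boldsymbol a^*-\bar{\boldsymbol g}|$, $|\boldsymbol h\cdot(\boldsymbol a-\bar{\boldsymbol g})|$, $|\bar{\boldsymbol\imath}\times\boldsymbol v_a|$ and $|\boldsymbol\imath\cdot\boldsymbol v|$ stay larger than some positive number, and that $\tilde\theta(0)\neq\pi$. Then: 1. $|\boldsymbol v|-v^*\to0$; the frame $\mathcal B$ converges to $\bar{\mathcal B}$ (that is, $\boldsymbol\imath-\bar{\boldsymbol\imath}$, $\boldsymbol\jmath-\bar{\boldsymbol\jmath}$, $\boldsymbol k-\bar{\boldsymbol k}$ tend to $\boldsymbol 0$); the lateral air-speed $v_{a,2}$ tends to $0$, and so does the sideslip angle $\beta$ provided that $|v_{a,1}|$ ultimately stays larger than some positive number (which is automatic in the absence of wind). 2. If $(\boldsymbol h,\boldsymbol z)$ does not converge to $(-\boldsymbol h^*,\boldsymbol 0)$ (that is, not both $\boldsymbol h+\boldsymbol h^*\to\boldsymbol0$ and $\boldsymbol z\to\boldsymbol0$), then $\boldsymbol h-\boldsymbol h^*\to\boldsymbol 0$ and $\boldsymbol z\to\boldsymbol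 0$. In this case, if $\boldsymbol h^*$ is given by the guidance law (G), then $\tilde{\boldsymbol p}\to\boldsymbol 0$ and $\boldsymbol h-\sigma\boldsymbol u\to\boldsymbol 0$. All these convergences are at an ultimately exponential rate: each of the quantities $f$ above satisfies $|f(t)|\le Ce^{-rt}$ for all large $t$, for some constants $C$ and $r>0$. -/

import Mathlib

open Set Filter Topology
open scoped RealInnerProductSpace

noncomputable section

namespace PathFollowing

/-- Three-dimensional Euclidean space (coordinates in the inertial frame). -/
abbrev E3 : Type := EuclideanSpace ℝ (Fin 3)

/-- The cross product of Euclidean vectors. -/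
def cross (a b : E3) : E3 := WithLp.toLp 2 (crossProduct a.ofLp b.ofLp)

/-- `(a, b, c)` is a right-handed orthonormal frame. -/
structure IsDirectFrame (a b c : E3) : Prop where
  norm_fst : ‖a‖ = 1
  norm_snd : ‖b‖ = 1
  orthogonal : ⟪a, b⟫ = 0
  thd_eq : c = cross a b

/-- Time derivative along a flight, which takes place on the time interval `[0, ∞)`. -/
def ddt {E : Type*} [NormedAddCommGroup E] [NormedSpace ℝ E] (f : ℝ → E) (t : ℝ) : E :=
  derivWithin f (Ici 0) t

/-- `f` converges to zero at an ultimately exponential rate. -/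
def TendsToZeroUltExp {E : Type*} [NormedAddCommGroup E] (f : ℝ → E) : Prop :=
  ∃ C : ℝ, ∃ r : ℝ, 0 < r ∧ ∀ᶠ t in atTop, ‖f t‖ ≤ C * Real.exp (-r * t)

/-! ### Smooth saturation -/

/-- The functions `x ↦ α Δ x` (`Δ > 0`) on `[0, ∞)` that define the smoothed saturations
`y ↦ α Δ ‖y‖ • y`. They are jointly continuous in the level `Δ` and in `x`, because the guidance
law uses a level that varies with time. (No condition is put on the second derivative
at zero, so that `α Δ x = (Δ / x) tanh (x / Δ)` is covered.) -/
structure IsSaturationFamily (α : ℝ → ℝ → ℝ) : Prop where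
  pos : ∀ Δ > 0, ∀ x ≥ 0, 0 < α Δ x
  at_zero : ∀ Δ > 0, α Δ 0 = 1
  strictAnti : ∀ Δ > 0, StrictAntiOn (α Δ) (Ici 0)
  differentiable : ∀ Δ > 0, DifferentiableOn ℝ (α Δ) (Ici 0)
  differentiable_deriv : ∀ Δ > 0, DifferentiableOn ℝ (derivWithin (α Δ) (Ici 0)) (Ici 0)
  deriv_zero : ∀ Δ > 0, derivWithin (α Δ) (Ici 0) 0 = 0
  le_level : ∀ Δ > 0, ∀ x > 0, α Δ x ≤ Δ / x
  tendsto_level : ∀ Δ > 0, Tendsto (fun x => α Δ x * x) atTop (𝓝 Δ)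
  continuous_joint : ContinuousOn (fun q : ℝ × ℝ => α q.1 q.2) (Ioi 0 ×ˢ Ici 0)

/-- The smoothed saturation with level `Δ`. -/
def sat {E : Type*} [NormedAddCommGroup E] [NormedSpace ℝ E] (α : ℝ → ℝ → ℝ) (Δ : ℝ) (y : E) : E :=
  α Δ ‖y‖ • y

/-! ### Aircraft, environment, flight -/

/-- Physical data: mass, gravity, coefficients of the aerodynamic force, and wind.
`O i j k w` is the vector that multiplies the lateral air-speed in the aerodynamic force, as an
arbitrary function of the body frame `(i, j, k)` and of the air-velocity `w`, with `|O| / |w|`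
bounded. -/
structure Aircraft where
  m : ℝ
  g₀ : ℝ
  c₀ : ℝ
  c₁ : ℝ
  /-- unit vector pointing vertically downward -/
  k₀ : E3
  O : E3 → E3 → E3 → E3 → E3
  /-- wind velocity -/
  vw : ℝ → E3
  m_pos : 0 < m
  g₀_pos : 0 < g₀
  c₀_pos : 0 < c₀
  c₁_pos : 0 < c₁
  norm_k₀ : ‖k₀‖ = 1
  O_bound : ∃ C : ℝ, ∀ i j k w : E3, IsDirectFrame i j k → w ≠ 0 → ‖O i j k w‖ / ‖w‖ ≤ C
  vw_differentiable : DifferentiableOn ℝ vw (Ici 0)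
  vw_bound : ∃ W : ℝ, ∀ t ≥ 0, ‖vw t‖ ≤ W

/-- The signals of a controlled flight: position, velocity, body frame `(i, j, k)`, and the
states `z` and `I` of the two integrators of the controller. -/
structure Flight where
  p : ℝ → E3
  v : ℝ → E3
  i : ℝ → E3
  j : ℝ → E3
  k : ℝ → E3
  z : ℝ → E3
  I : ℝ → ℝ

/-- Controller gains. -/
structure Gains where
  kT11 : ℝ
  kT12 : ℝ
  pT : ℝ
  /-- the integral gain of the thrust control, as a function of the speed error -/
  kT2 : ℝ → ℝ
  kT3 : ℝ
  ΔI : ℝ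
  kh1 : ℝ
  kh2 : ℝ
  kz : ℝ
  Δz : ℝ
  /-- the (time-varying) attitude gain -/
  kω : ℝ → ℝ
  kT11_pos : 0 < kT11
  kT12_pos : 0 < kT12
  one_lt_pT : 1 < pT
  kT2_pos : ∀ e, 0 < kT2 e
  kT2_ratio : ∃ r₁ r₂ : ℝ, 0 < r₁ ∧ ∀ e : ℝ,
    r₁ ≤ (kT11 + kT12 * |e| ^ pT) / kT2 e ∧ (kT11 + kT12 * |e| ^ pT) / kT2 e ≤ r₂
  kT3_pos : 0 < kT3
  ΔI_pos : 0 < ΔI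
  kh1_pos : 0 < kh1
  kh2_pos : 0 < kh2
  kz_pos : 0 < kz
  Δz_pos : 0 < Δz
  kω_pos : ∃ ε > 0, ∀ t ≥ 0, ε < kω t

/-- The proportional gain of the thrust control, as a function of the speed error. -/
def Gains.kT1 (G : Gains) (e : ℝ) : ℝ := G.kT11 + G.kT12 * |e| ^ G.pT

namespace Aircraft

variable (A : Aircraft) (F : Flight) (t : ℝ)

/-- `c̄₀ = c₀ + 2 c₁` -/
def cbar : ℝ := A.c₀ + 2 * A.c₁

/-- gravitational acceleration -/
def g : E3 := A.g₀ • A.k₀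

/-- air-velocity -/
def va : E3 := F.v t - A.vw t

def va1 : ℝ := ⟪A.va F t, F.i t⟫

def va2 : ℝ := ⟪A.va F t, F.j t⟫

def va3 : ℝ := ⟪A.va F t, F.k t⟫

/-- sideslip angle -/
def sideslip : ℝ := Real.arctan (A.va2 F t / A.va1 F t)

/-- aerodynamic force -/
def Fa : E3 :=
  -(‖A.va F t‖ • ((A.c₀ * A.va1 F t) • F.i t + (A.cbar * A.va3 F t) • F.k t))
    + A.va2 F t • A.O (F.i t) (F.j t) (F.k t) (A.va F t)

/-- `ḡ = g - (c̄₀ / m) |v_a| v_a` -/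
def gbar : E3 := A.g - (A.cbar / A.m * ‖A.va F t‖) • A.va F t

end Aircraft

/-- heading vector -/
def Flight.h (F : Flight) (t : ℝ) : E3 := (1 / ‖F.v t‖) • F.v t

/-- acceleration -/
def Flight.a (F : Flight) (t : ℝ) : E3 := ddt F.v t

/-- speed error, for the desired speed `vs` -/
def Flight.ev (F : Flight) (vs : ℝ → ℝ) (t : ℝ) : ℝ := ‖F.v t‖ - vs t

/-! ### The control laws

`α` is the saturation family, `G` the gains, `vs` the desired speed, `hs` the desired heading. -/

section Control

variable (A : Aircraft) (α : ℝ → ℝ → ℝ) (G : Gains) (vs : ℝ → ℝ) (hs : ℝ → E3) (F : Flight) (t : ℝ)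

/-- `T̄`, the thrust command augmented with the aerodynamic term along `i` -/
def Tbar : ℝ :=
  A.m * (-⟪A.gbar F t, F.h t⟫ + ddt vs t - G.kT1 (F.ev vs t) * F.ev vs t
      - G.kT2 (F.ev vs t) * α G.ΔI |F.I t + F.ev vs t / G.kT3| * F.I t)
    / ⟪F.i t, F.h t⟫

/-- the thrust -/
def thrust : ℝ := Tbar A α G vs F t - 2 * A.c₁ * A.va1 F t * ‖A.va F t‖

/-- right-hand side of the equation of the bounded integral of the speed error -/
def Irate : ℝ :=
  G.kT2 (F.ev vs t) * G.kT3 * (-F.I t + sat α G.ΔI (F.I t + F.ev vs t / G.kT3))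

/-- angular velocity of the desired heading -/
def omegaHs : E3 := cross (hs t) (ddt hs t)

/-- heading error `h × h*` -/
def htilde : E3 := cross (F.h t) (hs t)

/-- right-hand side of the equation of the bounded integral of the heading error -/
def zrate : E3 :=
  cross (omegaHs hs t) (F.z t)
    + G.kz • (-F.z t + sat α G.Δz (F.z t + (1 / G.kz) • htilde hs F t))

/-- desired angular velocity of the heading vector -/
def omegaHbar : E3 :=
  omegaHs hs t + G.kh1 • htilde hs F t
    + (G.kh2 * α G.Δz ‖F.z t + (1 / G.kz) • htilde hs F t‖) • F.z t

/-- desired acceleration `a*` -/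
def astar : E3 := ddt vs t • F.h t + ‖F.v t‖ • cross (omegaHbar α G hs F t) (F.h t)

/-- the desired body frame `(ī, j̄, k̄)` -/
def ibar : E3 :=
  (1 / ‖astar α G vs hs F t - A.gbar F t‖) • (astar α G vs hs F t - A.gbar F t)

def jbar : E3 :=
  (1 / ‖cross (A.va F t) (ibar A α G vs hs F t)‖) • cross (A.va F t) (ibar A α G vs hs F t)

def kbar : E3 := cross (ibar A α G vs hs F t) (jbar A α G vs hs F t)

/-- angular velocities of `ī`, of `j̄` and of the desired frame -/
def omegaIbar : E3 := cross (ibar A α G vs hs F t) (ddt (ibar A α G vs hs F) t)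

def omegaJbar : E3 := cross (jbar A α G vs hs F t) (ddt (jbar A α G vs hs F) t)

def omegaBar : E3 :=
  omegaIbar A α G vs hs F t
    + ⟪ibar A α G vs hs F t, omegaJbar A α G vs hs F t⟫ • ibar A α G vs hs F t

/-- the attitude (angular velocity) control -/
def omega : E3 :=
  omegaBar A α G vs hs F t
    + G.kω t • (cross (F.i t) (ibar A α G vs hs F t) + cross (F.j t) (jbar A α G vs hs F t)
      + cross (F.k t) (kbar A α G vs hs F t))

/-- the angle in `[0, π]` of the rotation between the body frame and the desired frame,
`1 + 2 cos θ` being the trace of the rotation matrix -/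
def frameAngle : ℝ :=
  Real.arccos ((⟪F.i t, ibar A α G vs hs F t⟫ + ⟪F.j t, jbar A α G vs hs F t⟫
    + ⟪F.k t, kbar A α G vs hs F t⟫ - 1) / 2)

end Control

/-- `vs` is an admissible desired speed: positive, differentiable, bounded together with its
derivative. -/
structure IsDesiredSpeed (vs : ℝ → ℝ) : Prop where
  pos : ∀ t ≥ 0, 0 < vs t
  differentiable : DifferentiableOn ℝ vs (Ici 0)
  bound : ∃ B : ℝ, ∀ t ≥ 0, vs t ≤ B
  deriv_bound : ∃ B : ℝ, ∀ t ≥ 0, |ddt vs t| ≤ B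

/-- `F` is a solution, on `[0, ∞)`, of the equations of motion of the aircraft `A` under the
thrust control and the attitude control, with desired speed `vs` and desired heading `hs`. -/
structure IsClosedLoop (A : Aircraft) (α : ℝ → ℝ → ℝ) (G : Gains) (vs : ℝ → ℝ) (hs : ℝ → E3)
    (F : Flight) : Prop where
  body_frame : ∀ t ≥ 0, IsDirectFrame (F.i t) (F.j t) (F.k t)
  position : ∀ t ≥ 0, HasDerivWithinAt F.p (F.v t) (Ici 0) t
  velocity_differentiable : DifferentiableOn ℝ F.v (Ici 0)
  newton : ∀ t ≥ 0, A.m • F.a t = A.m • A.g + A.Fa F t + thrust A α G vs F t • F.i t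
  attitude_i : ∀ t ≥ 0, HasDerivWithinAt F.i (cross (omega A α G vs hs F t) (F.i t)) (Ici 0) t
  attitude_j : ∀ t ≥ 0, HasDerivWithinAt F.j (cross (omega A α G vs hs F t) (F.j t)) (Ici 0) t
  attitude_k : ∀ t ≥ 0, HasDerivWithinAt F.k (cross (omega A α G vs hs F t) (F.k t)) (Ici 0) t
  speed_integrator : ∀ t ≥ 0, HasDerivWithinAt F.I (Irate α G vs F t) (Ici 0) t
  heading_integrator : ∀ t ≥ 0, HasDerivWithinAt F.z (zrate α G hs F t) (Ici 0) t
  heading_integrator_init : F.z 0 = 0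
  norm_heading : ∀ t ≥ 0, ‖hs t‖ = 1
  heading_differentiable : DifferentiableOn ℝ hs (Ici 0)
  ibar_differentiable : DifferentiableOn ℝ (ibar A α G vs hs F) (Ici 0)
  jbar_differentiable : DifferentiableOn ℝ (jbar A α G vs hs F) (Ici 0)

/-! ### The path and the guidance law -/

/-- A curve `q` parametrized by arc length, with a parallel transport frame `(u, u₁, u₂)` and
bounded functions `γ₁, γ₂`. Differentiability of `γ₁, γ₂` amounts to `q` being three times
differentiable. -/
structure Path where
  q : ℝ → E3
  u : ℝ → E3
  u₁ : ℝ → E3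
  u₂ : ℝ → E3
  γ₁ : ℝ → ℝ
  γ₂ : ℝ → ℝ
  frame : ∀ s, IsDirectFrame (u s) (u₁ s) (u₂ s)
  deriv_q : ∀ s, HasDerivAt q (u s) s
  deriv_u : ∀ s, HasDerivAt u (γ₁ s • u₁ s + γ₂ s • u₂ s) s
  deriv_u₁ : ∀ s, HasDerivAt u₁ (-(γ₁ s • u s)) s
  deriv_u₂ : ∀ s, HasDerivAt u₂ (-(γ₂ s • u s)) s
  γ₁_differentiable : Differentiable ℝ γ₁
  γ₂_differentiable : Differentiable ℝ γ₂
  γ_bound : ∃ B : ℝ, ∀ s, |γ₁ s| ≤ B ∧ |γ₂ s| ≤ B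

section Guidance

variable (P : Path) (F : Flight) (s : ℝ → ℝ) (t : ℝ)

/-- `s t` is the abscissa of the projection of the aircraft on the path: the point of the path
(locally) closest to the aircraft, depending differentiably on time. -/
structure IsProjection : Prop where
  differentiable : DifferentiableOn ℝ s (Ici 0)
  closest : ∀ t ≥ 0, IsLocalMin (fun σ => ‖F.p t - P.q σ‖) (s t)

/-- position error -/
def ptilde : E3 := F.p t - P.q (s t)

/-- coordinates `(y₁, y₂)` of the position error in the parallel transport frame -/
def yerr : EuclideanSpace ℝ (Fin 2) :=
  !₂[⟪ptilde P F s t, P.u₁ (s t)⟫, ⟪ptilde P F s t, P.u₂ (s t)⟫]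

/-- `1 - γ₁ y₁ - γ₂ y₂` -/
def conditioning : ℝ :=
  1 - P.γ₁ (s t) * yerr P F s t 0 - P.γ₂ (s t) * yerr P F s t 1

/-- Parameters of the guidance law; `σ` is the chosen direction of travel along the path. -/
structure GuidanceParams where
  k₁ : ℝ
  d₁ : ℝ
  d₂ : ℝ
  μ : ℝ
  σ : ℝ
  k₁_pos : 0 < k₁
  d₁_mem : d₁ ∈ Ioc (0 : ℝ) 1
  d₂_mem : d₂ ∈ Ioc (0 : ℝ) 1
  μ_mem : μ ∈ Ioo (0 : ℝ) 1
  σ_eq : σ = 1 ∨ σ = -1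

variable (α : ℝ → ℝ → ℝ) (Q : GuidanceParams)

/-- the saturation level `Δ_h` -/
def levelH : ℝ := Q.μ * ‖F.v t‖ / (Q.k₁ * max Q.d₁ Q.d₂)

/-- `ȳ = k₁ D sat(y) / |v|` with `D = diag(d₁, d₂)` -/
def ybar : EuclideanSpace ℝ (Fin 2) :=
  !₂[Q.k₁ * Q.d₁ * sat α (levelH F t Q) (yerr P F s t) 0 / ‖F.v t‖,
     Q.k₁ * Q.d₂ * sat α (levelH F t Q) (yerr P F s t) 1 / ‖F.v t‖]

def thetaH : ℝ :=
  Real.arctan (‖ybar P F s t α Q‖ / Real.sqrt (1 - ‖ybar P F s t α Q‖ ^ 2))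

/-- The unit vector `l`. When `ȳ = 0` it is irrelevant (its coefficient in the heading vanishes)
and this expression is zero. -/
def lvec : E3 :=
  -((1 / ‖ybar P F s t α Q‖) •
    (ybar P F s t α Q 0 • P.u₁ (s t) + ybar P F s t α Q 1 • P.u₂ (s t)))

/-- the desired heading given by the guidance law -/
def guidanceHeading : E3 :=
  Real.sin (thetaH P F s t α Q) • lvec P F s t α Q
    + (Real.cos (thetaH P F s t α Q) * Q.σ) • P.u (s t)

end Guidance

end PathFollowing

end

open PathFollowing

/-! The closed loop is a cascade: attitude, then speed, then acceleration, then heading, then path.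
Each stage converges exponentially and enters the next only as an exponentially decaying
perturbation. The common tool is the Grönwall-type lemma `TendsToZeroUltExp.of_deriv_le`.

Attitude (`frame_tracking`). The feed-forward cancels the motion of the desired frame, and the trace
`tr` of the relative rotation satisfies `tr' = k_ω (1 + tr)(3 - tr)`. Starting above `-1`, it tends
exponentially to `3`. As `j̄` is orthogonal to the air-velocity, `v_{a,2}` is at most `|v_a| |j -
j̄|`.

Speed (`speedError_bounded`, `speed_loop`). The speed error obeys a proportional-integral loop
perturbed by a term of order `|v_a| |v_{a,2}|`. This is at most quadratic in the speed, and the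
superlinear gain dominates it, so the speed is bounded. Then `v_{a,2}` and the perturbation decay
exponentially, and a quadratic Lyapunov function with a small cross term `e I` gives exponential
convergence.

Acceleration (`IsClosedLoop.acceleration_tracking`). Up to a lateral term, `a - ḡ` is a multiple of
`i`, while `a* - ḡ` is a multiple of `ī`. Their components along `h` agree asymptotically, and `h ·
i` stays away from zero, so `a - a*` decays.

Heading (`heading_loop_scalar`). With `c = h · h*`, `n = |z|²` and `x = (h × h*) · z`, the function
`V = 1 - c + k₂ n / 2` is only nonincreasing up to the perturbation. Adding `η c x` gives a
derivative at most `-κ' (1 - c² + n)` plus a decaying term. Barbalat's lemma then yields `1 - c² →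
0` and `n → 0`. Either `c → -1`, or the near-monotonicity of `V` keeps `c` away from `-1`; then `1 -
c²` is comparable to `1 - c` and the decay is exponential.

Path (`IsProjection.path_following`). The path error is orthogonal to the tangent, so its squared
norm has derivative `2 p̃ · v`, and the guidance heading makes this negative up to the heading
error. -/

namespace PathFollowing

/-! ### Functions that decay exponentially -/

namespace TendsToZeroUltExp

variable {E E' : Type*} [NormedAddCommGroup E] [NormedAddCommGroup E'] {f g : ℝ → E}

theorem of_le {g : ℝ → E'} (hg : TendsToZeroUltExp g) (K : ℝ)
    (h : ∀ᶠ t in atTop, ‖f t‖ ≤ K * ‖g t‖) : TendsToZeroUltExp f := by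
  obtain ⟨C, r, hr, hC⟩ := hg
  refine ⟨|K| * C, r, hr, ?_⟩
  filter_upwards [h, hC] with t h1 h2
  calc ‖f t‖ ≤ K * ‖g t‖ := h1
    _ ≤ |K| * ‖g t‖ := by gcongr; exact le_abs_self K
    _ ≤ |K| * (C * Real.exp (-r * t)) := by gcongr
    _ = _ := by ring

theorem congr' (hg : TendsToZeroUltExp g) (h : ∀ᶠ t in atTop, f t = g t) :
    TendsToZeroUltExp f :=
  hg.of_le 1 (by filter_upwards [h] with t ht; simp [ht])

theorem weaken {C r r' : ℝ} (hr : r' ≤ r)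
    (h : ∀ᶠ t in atTop, ‖f t‖ ≤ C * Real.exp (-r * t)) :
    ∀ᶠ t in atTop, ‖f t‖ ≤ C * Real.exp (-r' * t) := by
  filter_upwards [h, eventually_ge_atTop 0] with t ht h0
  have hC : 0 ≤ C := by
    by_contra hC
    have := Real.exp_pos (-r * t)
    have := norm_nonneg (f t)
    nlinarith
  refine ht.trans ?_
  gcongr

theorem add (hf : TendsToZeroUltExp f) (hg : TendsToZeroUltExp g) :
    TendsToZeroUltExp (fun t => f t + g t) := by
  obtain ⟨C, r, hr, hC⟩ := hf
  obtain ⟨C', r', hr', hC'⟩ := hg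
  refine ⟨C + C', min r r', lt_min hr hr', ?_⟩
  filter_upwards [weaken (min_le_left r r') hC, weaken (min_le_right r r') hC'] with t h1 h2
  rw [add_mul]
  exact (norm_add_le _ _).trans (add_le_add h1 h2)

theorem neg (hf : TendsToZeroUltExp f) : TendsToZeroUltExp (fun t => -f t) :=
  hf.of_le 1 (by simp)

theorem sub (hf : TendsToZeroUltExp f) (hg : TendsToZeroUltExp g) :
    TendsToZeroUltExp (fun t => f t - g t) :=
  (hf.add hg.neg).congr' (by simp [sub_eq_add_neg])

theorem norm (hf : TendsToZeroUltExp f) : TendsToZeroUltExp (fun t => ‖f t‖) :=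
  hf.of_le 1 (by simp)

/-- The Lyapunov functions are quadratic in the errors; the square root halves the exponential rate.
-/
theorem of_sq_le {g : ℝ → E'} (hg : TendsToZeroUltExp g) (K : ℝ)
    (h : ∀ᶠ t in atTop, ‖f t‖ ^ 2 ≤ K * ‖g t‖) : TendsToZeroUltExp f := by
  obtain ⟨C, r, hr, hC⟩ := hg
  refine ⟨√(|K| * |C|), r / 2, by positivity, ?_⟩
  filter_upwards [h, hC] with t h1 h2
  refine abs_le_of_sq_le_sq' ?_ (by positivity) |>.2
  rw [mul_pow, Real.sq_sqrt (by positivity), ← Real.exp_nat_mul]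
  calc ‖f t‖ ^ 2 ≤ K * ‖g t‖ := h1
    _ ≤ |K| * ‖g t‖ := by gcongr; exact le_abs_self K
    _ ≤ |K| * (|C| * Real.exp (-r * t)) := by
      gcongr
      exact h2.trans (by gcongr; exact le_abs_self C)
    _ = _ := by rw [mul_assoc]; congr 3; push_cast; ring

theorem tendsto (hf : TendsToZeroUltExp f) : Tendsto f atTop (𝓝 0) := by
  obtain ⟨C, r, hr, hC⟩ := hf
  refine squeeze_zero_norm' hC ?_
  have : Tendsto (fun t : ℝ => -r * t) atTop atBot :=
    tendsto_id.const_mul_atTop_of_neg (neg_lt_zero.mpr hr)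
  simpa using (Real.tendsto_exp_atBot.comp this).const_mul C

theorem eventually_norm_le (hf : TendsToZeroUltExp f) {ε : ℝ} (hε : 0 < ε) :
    ∀ᶠ t in atTop, ‖f t‖ ≤ ε := by
  have := hf.tendsto.norm
  rw [norm_zero] at this
  filter_upwards [this.eventually (gt_mem_nhds hε)] with t ht using ht.le

end TendsToZeroUltExp

/-! ### Differential inequalities near infinity -/

/-- A function that decreases whenever it is above a level is bounded. -/
theorem eventually_le_of_deriv_nonpos_above {f f' : ℝ → ℝ} (B : ℝ)
    (hf : ∀ᶠ t in atTop, HasDerivAt f (f' t) t) (h : ∀ᶠ t in atTop, B ≤ f t → f' t ≤ 0) :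
    ∃ M, ∀ᶠ t in atTop, f t ≤ M := by
  obtain ⟨T, hT⟩ := eventually_atTop.1 (hf.and h)
  refine ⟨max (f T) B + 1, ?_⟩
  filter_upwards [eventually_ge_atTop T] with t ht
  -- Only `f' ≤ 0` is known above the level, so `f` is compared with a barrier of slope `ε > 0`. The
  -- barrier lies strictly above `B`, so the hypothesis applies wherever `f` touches it.
  have key : ∀ ε > 0, f t ≤ max (f T) B + ε * (1 + t - T) := by
    intro ε hε
    have hB : ∀ x, HasDerivAt (fun s => max (f T) B + ε * (1 + s - T)) ε x := by
      intro x
      have := ((((hasDerivAt_id x).const_add 1).sub_const T).const_mul ε).const_add (max (f T) B)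
      simpa using this
    refine image_le_of_deriv_right_lt_deriv_boundary (a := T) (b := t) (f := f) (f' := f')
      (B := fun s => max (f T) B + ε * (1 + s - T)) (B' := fun _ => ε) ?_ ?_ ?_ hB ?_ ⟨ht, le_rfl⟩
    · exact fun x hx => (hT x hx.1).1.continuousAt.continuousWithinAt
    · exact fun x hx => (hT x hx.1).1.hasDerivWithinAt
    · have := le_max_left (f T) B
      simp only [add_sub_cancel_right, mul_one]
      linarith
    · intro x hx hfx
      refine lt_of_le_of_lt ((hT x hx.1).2 ?_) hε
      have : 0 < ε * (1 + x - T) := mul_pos hε (by linarith [hx.1])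
      linarith [le_max_right (f T) B]
  have hpos : 0 < 1 + t - T := by linarith
  -- With `ε` depending on the final time `t`, the barrier adds exactly `1` there.
  have := key (1 / (1 + t - T)) (by positivity)
  rwa [one_div, inv_mul_cancel₀ hpos.ne'] at this

/-- The primitive of a decaying exponential absorbs an exponentially decaying forcing term. -/
theorem exists_antitone_correction {W W' f g : ℝ → ℝ}
    (hW : ∀ᶠ t in atTop, HasDerivAt W (W' t) t) (hg : TendsToZeroUltExp g)
    (h : ∀ᶠ t in atTop, W' t ≤ -f t + g t) :
    ∃ η η' : ℝ → ℝ, TendsToZeroUltExp η ∧ (∀ᶠ t in atTop, 0 ≤ η t) ∧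
      (∀ᶠ t in atTop, HasDerivAt (fun t => W t + η t) (η' t) t ∧ η' t ≤ -f t) := by
  obtain ⟨C, r, hr, hC⟩ := hg
  have hC0 : 0 ≤ C := by
    obtain ⟨t, ht⟩ := hC.exists
    by_contra hneg
    have := Real.exp_pos (-r * t)
    have := norm_nonneg (g t)
    nlinarith
  -- The derivative of `C / r * exp (-r t)` is `-C exp (-r t)`, which cancels the bound on `g`.
  refine ⟨fun t => C / r * Real.exp (-r * t), fun t => W' t - C * Real.exp (-r * t), ?_, ?_, ?_⟩
  · refine ⟨C / r, r, hr, Eventually.of_forall fun t => ?_⟩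
    rw [Real.norm_eq_abs, abs_of_nonneg (by positivity)]
  · exact Eventually.of_forall fun t => by positivity
  · filter_upwards [hW, h, hC] with t h1 h2 h3
    refine ⟨?_, ?_⟩
    · have h4 : HasDerivAt (fun t : ℝ => C / r * Real.exp (-r * t))
          (C / r * (Real.exp (-r * t) * (-r * 1))) t :=
        (((hasDerivAt_id t).const_mul (-r)).exp).const_mul (C / r)
      refine (h1.add h4).congr_deriv ?_
      field_simp
      ring
    · have := (le_abs_self (g t)).trans h3
      linarith

theorem antitoneOn_Ici_of_hasDerivAt {f f' : ℝ → ℝ} {T : ℝ}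
    (hf : ∀ t ≥ T, HasDerivAt f (f' t) t) (h : ∀ t ≥ T, f' t ≤ 0) : AntitoneOn f (Ici T) :=
  antitoneOn_of_hasDerivWithinAt_nonpos (convex_Ici T)
    (fun t ht => (hf t ht).continuousAt.continuousWithinAt)
    (fun t ht => (hf t (interior_subset ht)).hasDerivWithinAt)
    (fun t ht => h t (interior_subset ht))

/-- Grönwall's lemma with a decaying forcing term: after multiplication by an integrating factor,
the forcing is still exponentially decaying, so the product is decreasing up to a vanishing
correction. -/
theorem TendsToZeroUltExp.of_deriv_le {f f' g : ℝ → ℝ} {c : ℝ} (hc : 0 < c)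
    (hf : ∀ᶠ t in atTop, HasDerivAt f (f' t) t) (hf0 : ∀ᶠ t in atTop, 0 ≤ f t)
    (hg : TendsToZeroUltExp g) (h : ∀ᶠ t in atTop, f' t ≤ -c * f t + g t) :
    TendsToZeroUltExp f := by
  obtain ⟨C, r, hr, hC⟩ := hg
  -- The exponent must be at most `c`, which costs nothing since `f ≥ 0`, and strictly below the
  -- rate `r` of `g`, so that `exp (c' t) * g t` still decays.
  set c' := min c (r / 2) with hc'
  have hc'0 : 0 < c' := lt_min hc (by positivity)
  have hc'c : c' ≤ c := min_le_left _ _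
  have hc'r : c' < r := (min_le_right c (r / 2)).trans_lt (by linarith)
  have hW : ∀ᶠ t in atTop, HasDerivAt (fun t => Real.exp (c' * t) * f t)
      (Real.exp (c' * t) * (c' * 1) * f t + Real.exp (c' * t) * f' t) t := by
    filter_upwards [hf] with t ht
    exact (((hasDerivAt_id t).const_mul c').exp).mul ht
  have hg : TendsToZeroUltExp (fun t => Real.exp (c' * t) * g t) := by
    refine ⟨C, r - c', by linarith, ?_⟩
    filter_upwards [hC] with t ht
    rw [norm_mul, Real.norm_eq_abs, abs_of_pos (Real.exp_pos _)]
    calc Real.exp (c' * t) * ‖g t‖ ≤ Real.exp (c' * t) * (C * Real.exp (-r * t)) := by gcongr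
      _ = C * (Real.exp (c' * t) * Real.exp (-r * t)) := by ring
      _ = _ := by rw [← Real.exp_add]; ring_nf
  obtain ⟨η, η', hη, hη0, hd⟩ := exists_antitone_correction (f := fun _ => 0) hW hg (by
    filter_upwards [h, hf0] with t h1 h2
    have h3 := Real.exp_pos (c' * t)
    have h4 : c' * f t + f' t ≤ g t := by nlinarith
    nlinarith)
  obtain ⟨T, hT⟩ := eventually_atTop.1 (hd.and (hf0.and hη0))
  have hanti := antitoneOn_Ici_of_hasDerivAt (fun t ht => (hT t ht).1.1)
    (fun t ht => by simpa using (hT t ht).1.2)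
  refine ⟨Real.exp (c' * T) * f T + η T, c', hc'0, ?_⟩
  filter_upwards [eventually_ge_atTop T] with t ht
  have h1 := hanti (mem_Ici.2 le_rfl) ht ht
  simp only at h1
  rw [Real.norm_eq_abs, abs_of_nonneg (hT t ht).2.1, neg_mul, Real.exp_neg, ← div_eq_mul_inv,
    le_div_iff₀ (Real.exp_pos _)]
  linarith [(hT t ht).2.2]

/-- A form of Barbalat's lemma. -/
theorem tendsto_zero_of_deriv_le_neg {W W' f f' g : ℝ → ℝ} {L B : ℝ}
    (hW : ∀ᶠ t in atTop, HasDerivAt W (W' t) t) (hB : ∀ᶠ t in atTop, B ≤ W t)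
    (hf : ∀ᶠ t in atTop, HasDerivAt f (f' t) t) (hL : ∀ᶠ t in atTop, |f' t| ≤ L)
    (hf0 : ∀ᶠ t in atTop, 0 ≤ f t) (hg : TendsToZeroUltExp g)
    (h : ∀ᶠ t in atTop, W' t ≤ -f t + g t) : Tendsto f atTop (𝓝 0) := by
  obtain ⟨η, η', hη, hη0, hd⟩ := exists_antitone_correction hW hg h
  obtain ⟨T, hT⟩ := eventually_atTop.1 (hd.and (hf0.and (hη0.and (hB.and (hf.and hL)))))
  have hanti : AntitoneOn (fun t => W t + η t) (Ici T) :=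
    antitoneOn_Ici_of_hasDerivAt (fun t ht => (hT t ht).1.1)
      (fun t ht => (hT t ht).1.2.trans (by simpa using (hT t ht).2.1))
  -- Freezing the function before `T` makes it antitone on the whole line, so that it has a limit or
  -- tends to `-∞`.
  set U := fun t => W (max T t) + η (max T t) with hU
  have hUanti : Antitone U := fun a b hab =>
    hanti (mem_Ici.2 (le_max_left _ _)) (mem_Ici.2 (le_max_left _ _)) (max_le_max le_rfl hab)
  obtain ⟨l, hl⟩ : ∃ l, Tendsto U atTop (𝓝 l) := by
    rcases tendsto_atTop_of_antitone hUanti with h | h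
    · obtain ⟨t, ht⟩ := (h.eventually (eventually_lt_atBot B)).exists
      have h1 := (hT (max T t) (le_max_left _ _)).2.2
      simp only [hU] at ht
      linarith [h1.1, h1.2.1]
    · exact h
  have hL0 : 0 ≤ L := (abs_nonneg _).trans (hT T le_rfl).2.2.2.2.2
  rw [Metric.tendsto_atTop]
  intro ε hε
  -- If `f t ≥ ε`, the slope bound `L` keeps `f ≥ ε / 2` on `[t, t + d]`, so `W + η` drops by at
  -- least `d ε / 2` there. This is impossible once both end values are within less than `d ε / 4`
  -- of the limit. The `+ 1` covers `L = 0`.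
  set d := ε / (2 * (L + 1)) with hdd
  have hd0 : 0 < d := by positivity
  obtain ⟨N, hN⟩ := Metric.tendsto_atTop.1 hl (d * ε / 4) (by positivity)
  refine ⟨max N T, fun t ht => ?_⟩
  have htT : T ≤ t := (le_max_right _ _).trans ht
  rw [Real.dist_eq, sub_zero, abs_of_nonneg (hT t htT).2.1]
  by_contra! hcon
  have hlow : ∀ x ∈ Icc t (t + d), ε / 2 ≤ f x := by
    intro x hx
    have := (convex_Icc t (t + d)).norm_image_sub_le_of_norm_hasDerivWithin_le
      (fun y hy => (hT y (htT.trans hy.1)).2.2.2.2.1.hasDerivWithinAt)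
      (fun y hy => (hT y (htT.trans hy.1)).2.2.2.2.2)
      (left_mem_Icc.2 (by linarith)) hx
    rw [Real.norm_eq_abs, Real.norm_eq_abs, abs_of_nonneg (sub_nonneg.2 hx.1)] at this
    have h1 := (abs_le.1 this).1
    have h2 : L * (x - t) ≤ (L + 1) * d := by
      have := hx.2
      have := hx.1
      exact mul_le_mul (by linarith) (by linarith) (by linarith) (by linarith)
    have h3 : (L + 1) * d = ε / 2 := by rw [hdd]; field_simp
    linarith
  have hdec : W (t + d) + η (t + d) + ε / 2 * (t + d) ≤ W t + η t + ε / 2 * t := by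
    have h5 : AntitoneOn (fun x => W x + η x + ε / 2 * x) (Icc t (t + d)) := by
      refine antitoneOn_of_hasDerivWithinAt_nonpos (convex_Icc _ _)
        (f' := fun x => η' x + ε / 2 * 1) ?_ ?_ ?_
      · intro x hx
        exact ((hT x (htT.trans hx.1)).1.1.add ((hasDerivAt_id x).const_mul (ε / 2))
          ).continuousAt.continuousWithinAt
      · intro x hx
        have hx := interior_subset hx
        exact ((hT x (htT.trans hx.1)).1.1.add ((hasDerivAt_id x).const_mul (ε / 2))
          ).hasDerivWithinAt
      · intro x hx
        have hx := interior_subset hx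
        have := (hT x (htT.trans hx.1)).1.2
        have := hlow x hx
        linarith
    exact h5 (left_mem_Icc.2 (by linarith)) (right_mem_Icc.2 (by linarith)) (by linarith)
  have e1 := hN t ((le_max_left _ _).trans ht)
  have e2 := hN (t + d) (((le_max_left _ _).trans ht).trans (by linarith))
  simp only [hU, Real.dist_eq, max_eq_right htT, max_eq_right (show T ≤ t + d by linarith)] at e1 e2
  rw [abs_lt] at e1 e2
  have : 0 < d * ε := by positivity
  nlinarith [e1.2, e2.1]

/-! ### Cross product -/

theorem cross_apply_zero (a b : E3) : cross a b 0 = a 1 * b 2 - a 2 * b 1 := rfl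
theorem cross_apply_one (a b : E3) : cross a b 1 = a 2 * b 0 - a 0 * b 2 := rfl
theorem cross_apply_two (a b : E3) : cross a b 2 = a 0 * b 1 - a 1 * b 0 := rfl

theorem inner_eq_sum (a b : E3) : ⟪a, b⟫ = a 0 * b 0 + a 1 * b 1 + a 2 * b 2 := by
  simp [PiLp.inner_apply, Fin.sum_univ_three, mul_comm]

theorem E3_ext {a b : E3} (h0 : a 0 = b 0) (h1 : a 1 = b 1) (h2 : a 2 = b 2) : a = b := by
  ext i
  fin_cases i
  exacts [h0, h1, h2]

theorem cross_add_left (a b c : E3) : cross (a + b) c = cross a c + cross b c := by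
  apply E3_ext <;> simp only [cross_apply_zero, cross_apply_one, cross_apply_two, PiLp.add_apply] <;>
    ring

theorem cross_smul_left (r : ℝ) (a b : E3) : cross (r • a) b = r • cross a b := by
  apply E3_ext <;> simp only [cross_apply_zero, cross_apply_one, cross_apply_two, PiLp.smul_apply,
    smul_eq_mul] <;> ring

theorem inner_cross_cross (a b c d : E3) :
    ⟪cross a b, cross c d⟫ = ⟪a, c⟫ * ⟪b, d⟫ - ⟪a, d⟫ * ⟪b, c⟫ := by
  simp only [inner_eq_sum, cross_apply_zero, cross_apply_one, cross_apply_two]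
  ring

theorem cross_cross (a b c : E3) : cross (cross a b) c = ⟪a, c⟫ • b - ⟪b, c⟫ • a := by
  apply E3_ext <;> simp only [inner_eq_sum, cross_apply_zero, cross_apply_one, cross_apply_two,
    PiLp.sub_apply, PiLp.smul_apply, smul_eq_mul] <;> ring

theorem cross_swap (a b : E3) : cross a b = -cross b a := by
  apply E3_ext <;> simp only [cross_apply_zero, cross_apply_one, cross_apply_two, PiLp.neg_apply] <;>
    ring

theorem cross_jacobi (a b c : E3) :
    cross (cross a b) c + cross b (cross a c) = cross a (cross b c) := by
  apply E3_ext <;> simp only [cross_apply_zero, cross_apply_one, cross_apply_two,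
    PiLp.add_apply] <;> ring

theorem inner_cross_left (a b c : E3) : ⟪cross a b, c⟫ = ⟪a, cross b c⟫ := by
  simp only [inner_eq_sum, cross_apply_zero, cross_apply_one, cross_apply_two]
  ring

theorem inner_cross_self_left (a b : E3) : ⟪cross a b, a⟫ = 0 := by
  simp only [inner_eq_sum, cross_apply_zero, cross_apply_one, cross_apply_two]
  ring

theorem inner_cross_self_right (a b : E3) : ⟪cross a b, b⟫ = 0 := by
  simp only [inner_eq_sum, cross_apply_zero, cross_apply_one, cross_apply_two]
  ring

theorem norm_cross_sq (a b : E3) : ‖cross a b‖ ^ 2 = ‖a‖ ^ 2 * ‖b‖ ^ 2 - ⟪a, b⟫ ^ 2 := by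
  simp only [← real_inner_self_eq_norm_sq, inner_cross_cross]
  rw [real_inner_comm a b]
  ring

theorem norm_cross_le (a b : E3) : ‖cross a b‖ ≤ ‖a‖ * ‖b‖ := by
  refine abs_le_of_sq_le_sq' ?_ (by positivity) |>.2
  rw [norm_cross_sq, mul_pow]
  linarith [sq_nonneg ⟪a, b⟫]

theorem hasDerivAt_cross {a b : ℝ → E3} {a' b' : E3} {t : ℝ} (ha : HasDerivAt a a' t)
    (hb : HasDerivAt b b' t) :
    HasDerivAt (fun t => cross (a t) (b t)) (cross a' (b t) + cross (a t) b') t := by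
  have key : ∀ i, HasDerivAt (fun t => cross (a t) (b t) i)
      ((cross a' (b t) + cross (a t) b') i) t := by
    have ha' := fun i => (hasDerivAt_pi.1 ((PiLp.hasStrictFDerivAt_ofLp 2 (a t)).hasFDerivAt.comp_hasDerivAt t ha)) i
    have hb' := fun i => (hasDerivAt_pi.1 ((PiLp.hasStrictFDerivAt_ofLp 2 (b t)).hasFDerivAt.comp_hasDerivAt t hb)) i
    simp at ha' hb'
    intro i
    fin_cases i
    · refine (((ha' 1).mul (hb' 2)).sub ((ha' 2).mul (hb' 1))).congr_deriv ?_
      simp [cross_apply_zero]; ring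
    · refine (((ha' 2).mul (hb' 0)).sub ((ha' 0).mul (hb' 2))).congr_deriv ?_
      simp [cross_apply_one]; ring
    · refine (((ha' 0).mul (hb' 1)).sub ((ha' 1).mul (hb' 0))).congr_deriv ?_
      simp [cross_apply_two]; ring
  have := (hasDerivAt_pi.2 key)
  exact (PiLp.hasStrictFDerivAt_toLp 2 _).hasFDerivAt.comp_hasDerivAt t this

/-! ### Frames -/

namespace IsDirectFrame

variable {a b c : E3} (h : IsDirectFrame a b c)
include h

theorem inner_fst_fst : ⟪a, a⟫ = 1 := by rw [real_inner_self_eq_norm_sq, h.norm_fst, one_pow]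

theorem inner_snd_snd : ⟪b, b⟫ = 1 := by rw [real_inner_self_eq_norm_sq, h.norm_snd, one_pow]

theorem inner_snd_fst : ⟪b, a⟫ = 0 := by rw [real_inner_comm, h.orthogonal]

theorem inner_thd_thd : ⟪c, c⟫ = 1 := by
  rw [h.thd_eq, inner_cross_cross, h.inner_fst_fst, h.inner_snd_snd, h.orthogonal]; norm_num

theorem norm_thd : ‖c‖ = 1 := by
  have := h.inner_thd_thd
  rw [real_inner_self_eq_norm_sq] at this
  exact (pow_eq_one_iff_of_nonneg (norm_nonneg c) two_ne_zero).1 this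

theorem inner_thd_fst : ⟪c, a⟫ = 0 := by rw [h.thd_eq, inner_cross_self_left]

theorem inner_thd_snd : ⟪c, b⟫ = 0 := by rw [h.thd_eq, inner_cross_self_right]

theorem inner_fst_thd : ⟪a, c⟫ = 0 := by rw [real_inner_comm, h.inner_thd_fst]

theorem inner_snd_thd : ⟪b, c⟫ = 0 := by rw [real_inner_comm, h.inner_thd_snd]

theorem cross_thd_fst : cross c a = b := by
  rw [h.thd_eq, cross_cross, h.inner_fst_fst, h.inner_snd_fst]; simp

theorem cross_snd_thd : cross b c = a := by
  rw [cross_swap, h.thd_eq, cross_cross, h.orthogonal, h.inner_snd_snd]; simp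

/-- The expansion is read off the double product `(c × w) × c = w - ⟪w, c⟫ c`. -/
theorem eq_add_add (w : E3) : w = ⟪w, a⟫ • a + ⟪w, b⟫ • b + ⟪w, c⟫ • c := by
  have h1 : cross c w = ⟪w, a⟫ • b - ⟪w, b⟫ • a := by
    rw [h.thd_eq, cross_cross, real_inner_comm, real_inner_comm b]
  have h2 := cross_cross c w c
  rw [h1, h.inner_thd_thd, one_smul, sub_eq_add_neg, cross_add_left, ← neg_smul, cross_smul_left,
    cross_smul_left, h.cross_snd_thd, cross_swap a c, h.cross_thd_fst] at h2
  rw [eq_sub_iff_add_eq] at h2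
  rw [neg_smul_neg] at h2
  exact h2.symm

end IsDirectFrame

/-- The left side is the derivative of `⟪a, b⟫` when `a` and `b` rotate with angular velocities `w`
and `w'`: only the relative angular velocity matters. -/
theorem inner_cross_add_inner_cross (w w' a b : E3) :
    ⟪cross w a, b⟫ + ⟪a, cross w' b⟫ = ⟪w - w', cross a b⟫ := by
  simp only [inner_eq_sum, cross_apply_zero, cross_apply_one, cross_apply_two, PiLp.sub_apply]
  ring

/-- The rotation axis between two frames, scaled by twice the sine of the rotation angle. -/
theorem norm_sq_frame_error {i j k i' j' k' : E3} (h : IsDirectFrame i j k)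
    (h' : IsDirectFrame i' j' k') :
    ‖cross i i' + cross j j' + cross k k'‖ ^ 2 =
      (1 + (⟪i, i'⟫ + ⟪j, j'⟫ + ⟪k, k'⟫)) * (3 - (⟪i, i'⟫ + ⟪j, j'⟫ + ⟪k, k'⟫)) := by
  -- Each diagonal entry of a rotation matrix equals its cofactor.
  have e1 : ⟪i, i'⟫ = ⟪j, j'⟫ * ⟪k, k'⟫ - ⟪j, k'⟫ * ⟪k, j'⟫ := by
    rw [← inner_cross_cross, h.cross_snd_thd, h'.cross_snd_thd]
  have e2 : ⟪j, j'⟫ = ⟪k, k'⟫ * ⟪i, i'⟫ - ⟪k, i'⟫ * ⟪i, k'⟫ := by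
    rw [← inner_cross_cross, h.cross_thd_fst, h'.cross_thd_fst]
  have e3 : ⟪k, k'⟫ = ⟪i, i'⟫ * ⟪j, j'⟫ - ⟪i, j'⟫ * ⟪j, i'⟫ := by
    rw [← inner_cross_cross, ← h.thd_eq, ← h'.thd_eq]
  rw [← real_inner_self_eq_norm_sq]
  simp only [inner_add_left, inner_add_right, inner_cross_cross, h.inner_fst_fst, h.inner_snd_snd,
    h.inner_thd_thd, h.orthogonal, h.inner_snd_fst, h.inner_thd_fst, h.inner_thd_snd,
    h.inner_fst_thd, h.inner_snd_thd, h'.inner_fst_fst, h'.inner_snd_snd, h'.inner_thd_thd,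
    h'.orthogonal, h'.inner_snd_fst, h'.inner_thd_fst, h'.inner_thd_snd, h'.inner_fst_thd,
    h'.inner_snd_thd, real_inner_comm i i', real_inner_comm i j', real_inner_comm i k',
    real_inner_comm j i', real_inner_comm j j', real_inner_comm j k', real_inner_comm k i',
    real_inner_comm k j', real_inner_comm k k']
  linear_combination -2 * e1 - 2 * e2 - 2 * e3

theorem inner_le_one {a b : E3} (ha : ‖a‖ = 1) (hb : ‖b‖ = 1) : ⟪a, b⟫ ≤ 1 := by
  simpa [ha, hb] using real_inner_le_norm a b

theorem norm_sub_sq_of_unit {a b : E3} (ha : ‖a‖ = 1) (hb : ‖b‖ = 1) :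
    ‖a - b‖ ^ 2 = 2 * (1 - ⟪a, b⟫) := by
  rw [norm_sub_sq_real, ha, hb]; ring

/-! ### Attitude control -/

/-- Exponential convergence of a frame that is steered towards a moving frame. -/
theorem frame_tracking {i j k i' j' k' Ω Ω' : ℝ → E3} {κ : ℝ → ℝ} {ε : ℝ} (hε : 0 < ε)
    (hfr : ∀ t ≥ 0, IsDirectFrame (i t) (j t) (k t))
    (hfr' : ∀ t ≥ 0, IsDirectFrame (i' t) (j' t) (k' t))
    (hi : ∀ t > 0, HasDerivAt i (cross (Ω t) (i t)) t)
    (hj : ∀ t > 0, HasDerivAt j (cross (Ω t) (j t)) t)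
    (hk : ∀ t > 0, HasDerivAt k (cross (Ω t) (k t)) t)
    (hi' : ∀ t > 0, HasDerivAt i' (cross (Ω' t) (i' t)) t)
    (hj' : ∀ t > 0, HasDerivAt j' (cross (Ω' t) (j' t)) t)
    (hk' : ∀ t > 0, HasDerivAt k' (cross (Ω' t) (k' t)) t)
    (hΩ : ∀ t ≥ 0, Ω t = Ω' t + κ t •
      (cross (i t) (i' t) + cross (j t) (j' t) + cross (k t) (k' t)))
    (hκ : ∀ t ≥ 0, ε < κ t)
    (hc : ContinuousOn (fun t => ⟪i t, i' t⟫ + ⟪j t, j' t⟫ + ⟪k t, k' t⟫) (Ici 0))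
    (h0 : -1 < ⟪i 0, i' 0⟫ + ⟪j 0, j' 0⟫ + ⟪k 0, k' 0⟫) :
    TendsToZeroUltExp (fun t => i t - i' t) ∧ TendsToZeroUltExp (fun t => j t - j' t) ∧
      TendsToZeroUltExp (fun t => k t - k' t) := by
  set tr : ℝ → ℝ := fun t => ⟪i t, i' t⟫ + ⟪j t, j' t⟫ + ⟪k t, k' t⟫ with htr
  -- The relative angular velocity is `κ` times the error axis, so the trace grows at the rate `κ`
  -- times the squared norm of that axis.
  have hd : ∀ t > 0, HasDerivAt tr (κ t * ((1 + tr t) * (3 - tr t))) t := by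
    intro t ht
    have h1 := (((hi t ht).inner ℝ (hi' t ht)).add ((hj t ht).inner ℝ (hj' t ht))).add
      ((hk t ht).inner ℝ (hk' t ht))
    refine h1.congr_deriv ?_
    rw [htr, ← norm_sq_frame_error (hfr t ht.le) (hfr' t ht.le), ← real_inner_self_eq_norm_sq,
      ← real_inner_smul_left, inner_add_right, inner_add_right]
    have e := hΩ t ht.le
    rw [← sub_eq_iff_eq_add'] at e
    simp only [← e]
    rw [← inner_cross_add_inner_cross, ← inner_cross_add_inner_cross,
      ← inner_cross_add_inner_cross]
    ring
  have hle : ∀ t ≥ 0, ⟪i t, i' t⟫ ≤ 1 ∧ ⟪j t, j' t⟫ ≤ 1 ∧ ⟪k t, k' t⟫ ≤ 1 := fun t ht =>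
    ⟨inner_le_one (hfr t ht).norm_fst (hfr' t ht).norm_fst,
      inner_le_one (hfr t ht).norm_snd (hfr' t ht).norm_snd,
      inner_le_one (hfr t ht).norm_thd (hfr' t ht).norm_thd⟩
  have hmono : MonotoneOn tr (Ici 0) := by
    refine monotoneOn_of_hasDerivWithinAt_nonneg (convex_Ici 0) hc
      (fun t ht => (hd t (by simpa using ht)).hasDerivWithinAt) (fun t ht => ?_)
    have ht : 0 < t := by simpa using ht
    rw [htr, ← norm_sq_frame_error (hfr t ht.le) (hfr' t ht.le)]
    have := hκ t ht.le
    exact mul_nonneg (by linarith) (sq_nonneg _)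
  have hlow : ∀ t ≥ 0, tr 0 ≤ tr t := fun t ht => hmono (mem_Ici.2 le_rfl) ht ht
  -- Monotonicity gives `1 + tr t ≥ 1 + tr 0 > 0`, whence the rate. The initial condition excludes a
  -- rotation by `π`, where the factor `1 + tr` vanishes.
  have key : TendsToZeroUltExp (fun t => 3 - tr t) := by
    refine TendsToZeroUltExp.of_deriv_le (f' := fun t => -(κ t * ((1 + tr t) * (3 - tr t))))
      (g := fun _ => 0) (c := ε * (1 + tr 0)) (mul_pos hε (by linarith)) ?_ ?_
      ⟨0, 1, one_pos, by simp⟩ ?_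
    · filter_upwards [eventually_gt_atTop 0] with t ht using (hd t ht).const_sub 3
    · filter_upwards [eventually_ge_atTop 0] with t ht
      have := hle t ht
      simp only [htr]
      linarith
    · filter_upwards [eventually_ge_atTop 0] with t ht
      have h1 := hle t ht
      have h2 : 0 ≤ 3 - tr t := by simp only [htr]; linarith
      have h3 : ε * (1 + tr 0) ≤ κ t * (1 + tr t) :=
        mul_le_mul (hκ t ht).le (by linarith [hlow t ht]) (by linarith)
          (hε.le.trans (hκ t ht).le)
      have := mul_le_mul_of_nonneg_right h3 h2
      linarith
  -- The three deficits `1 - ⟪i, i'⟫` and so on are nonnegative with sum `3 - tr`, so each is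
  -- controlled by it.
  refine ⟨key.of_sq_le 2 ?_, key.of_sq_le 2 ?_, key.of_sq_le 2 ?_⟩ <;>
  · filter_upwards [eventually_ge_atTop 0] with t ht
    have h1 := hle t ht
    have h2 : 3 - tr t ≤ ‖3 - tr t‖ := Real.le_norm_self _
    simp only [htr] at h2 ⊢
    first
    | rw [norm_sub_sq_of_unit (hfr t ht).norm_fst (hfr' t ht).norm_fst]; linarith
    | rw [norm_sub_sq_of_unit (hfr t ht).norm_snd (hfr' t ht).norm_snd]; linarith
    | rw [norm_sub_sq_of_unit (hfr t ht).norm_thd (hfr' t ht).norm_thd]; linarith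

/-! ### Saturation -/

namespace IsSaturationFamily

variable {α : ℝ → ℝ → ℝ} (hα : IsSaturationFamily α) {Δ : ℝ} (hΔ : 0 < Δ)
include hα hΔ

theorem le_of_le {x y : ℝ} (hx : 0 ≤ x) (hxy : x ≤ y) : α Δ y ≤ α Δ x :=
  (hα.strictAnti Δ hΔ).antitoneOn (mem_Ici.2 hx) (mem_Ici.2 (hx.trans hxy)) hxy

theorem le_one {x : ℝ} (hx : 0 ≤ x) : α Δ x ≤ 1 := by
  rw [← hα.at_zero Δ hΔ]
  exact hα.le_of_le hΔ le_rfl hx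

theorem mul_le {x : ℝ} (hx : 0 ≤ x) : α Δ x * x ≤ Δ := by
  rcases hx.eq_or_lt with rfl | hx
  · simpa using hΔ.le
  · exact (le_div_iff₀ hx).1 (hα.le_level Δ hΔ x hx)

theorem norm_sat_le {E : Type*} [NormedAddCommGroup E] [NormedSpace ℝ E] (y : E) :
    ‖sat α Δ y‖ ≤ Δ := by
  rw [sat, norm_smul, Real.norm_eq_abs, abs_of_pos (hα.pos Δ hΔ _ (norm_nonneg _))]
  exact hα.mul_le hΔ (norm_nonneg _)

end IsSaturationFamily

/-- Completing the square in the estimates of the cross terms of the Lyapunov functions. -/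
theorem exists_cross_term_weight {a A B L η₀ : ℝ} (ha : 0 < a) (hA : 0 ≤ A) (hB : 0 < B)
    (hη₀ : 0 < η₀) :
    ∃ η κ : ℝ, 0 < η ∧ η ≤ η₀ ∧ 0 < κ ∧ ∀ S N x : ℝ, 0 ≤ S → 0 ≤ N → x ^ 2 ≤ S * N →
      -a * S + η * (A * S + L * |x| - B * N) ≤ -κ * (S + N) := by
  -- `D` is the total coefficient of `S` after Young's inequality `L |x| ≤ L² / (2B) S + B / 2 N`;
  -- then `η` is chosen with `η D ≤ a / 2`.
  set D := A + L ^ 2 / (2 * B) with hD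
  have hD0 : 0 ≤ D := by positivity
  set η := min η₀ (a / (2 * (D + 1))) with hη
  have hη0 : 0 < η := lt_min hη₀ (by positivity)
  have hηD : η * D ≤ a / 2 := by
    have h1 : η ≤ a / (2 * (D + 1)) := min_le_right _ _
    have h2 : η * (2 * (D + 1)) ≤ a := (le_div_iff₀ (by positivity)).1 h1
    nlinarith
  refine ⟨η, min (a / 2) (η * (B / 2)), hη0, min_le_left _ _, by positivity, ?_⟩
  intro S N x hS hN hx
  have h1 : L * |x| ≤ L ^ 2 / (2 * B) * S + B / 2 * N := by
    refine abs_le_of_sq_le_sq' (b := L ^ 2 / (2 * B) * S + B / 2 * N) ?_ (by positivity) |>.2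
    have h2 : (L * |x|) ^ 2 ≤ L ^ 2 * (S * N) := by
      rw [mul_pow, sq_abs]; gcongr
    have h3 : L ^ 2 * (S * N) = 4 * (L ^ 2 / (2 * B) * S) * (B / 2 * N) := by
      field_simp; ring
    nlinarith [sq_nonneg (L ^ 2 / (2 * B) * S - B / 2 * N)]
  have h4 : η * (A * S + L * |x| - B * N) ≤ η * (D * S - B / 2 * N) := by
    refine mul_le_mul_of_nonneg_left ?_ hη0.le
    rw [hD]; linarith
  have h5 := mul_le_mul_of_nonneg_right hηD hS
  have h6 := mul_le_mul_of_nonneg_right (min_le_left (a / 2) (η * (B / 2))) hS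
  have h7 := mul_le_mul_of_nonneg_right (min_le_right (a / 2) (η * (B / 2))) hN
  nlinarith

/-! ### Speed control -/

/-- A proportional-integral loop with bounded integral action converges exponentially. -/
theorem speed_loop {e I k₁ k₂ a d : ℝ → ℝ} {κ K k₃ M : ℝ} (hκ : 0 < κ) (hk₃ : 0 < k₃)
    (he : ∀ᶠ t in atTop, HasDerivAt e (-k₁ t * e t - k₂ t * a t * I t + d t) t)
    (hI : ∀ᶠ t in atTop, HasDerivAt I (-k₂ t * k₃ * (1 - a t) * I t + k₂ t * a t * e t) t)
    (hk₁ : ∀ᶠ t in atTop, κ ≤ k₁ t ∧ k₁ t ≤ K) (hk₂ : ∀ᶠ t in atTop, κ ≤ k₂ t ∧ k₂ t ≤ K)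
    (ha : ∀ᶠ t in atTop, κ ≤ a t ∧ a t ≤ 1)
    (hbe : ∀ᶠ t in atTop, |e t| ≤ M) (hbI : ∀ᶠ t in atTop, |I t| ≤ M)
    (hd : TendsToZeroUltExp d) : TendsToZeroUltExp e ∧ TendsToZeroUltExp I := by
  have hK : 0 < K := by
    obtain ⟨t, ht⟩ := hk₁.exists
    linarith
  have hM : 0 ≤ M := by
    obtain ⟨t, ht⟩ := hbe.exists
    exact (abs_nonneg _).trans ht
  -- In the derivative of `(e² + I²) / 2` the coupling terms cancel, and nothing damps `I` when `a =
  -- 1`. The cross term `η e I` supplies `-η k₂ a I²`; the bound `η ≤ 1 / 2` keeps the sum positive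
  -- definite.
  obtain ⟨η, c, hη, hη', hc, hquad⟩ := exists_cross_term_weight (a := κ) (A := K) (B := κ ^ 2)
    (L := K + K * k₃) (η₀ := 1 / 2) hκ hK.le (by positivity) (by norm_num)
  have key : TendsToZeroUltExp (fun t => (e t ^ 2 + I t ^ 2) / 2 + η * (e t * I t)) := by
    refine TendsToZeroUltExp.of_deriv_le (c := c) hc
      (f' := fun t => (2 * e t * (-k₁ t * e t - k₂ t * a t * I t + d t) +
        2 * I t * (-k₂ t * k₃ * (1 - a t) * I t + k₂ t * a t * e t)) / 2 +
        η * ((-k₁ t * e t - k₂ t * a t * I t + d t) * I t +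
          e t * (-k₂ t * k₃ * (1 - a t) * I t + k₂ t * a t * e t)))
      (g := fun t => 2 * M * |d t|) ?_ ?_ ?_ ?_
    · filter_upwards [he, hI] with t h1 h2
      refine ((((h1.pow 2).add (h2.pow 2)).div_const 2).add ((h1.mul h2).const_mul η)).congr_deriv ?_
      simp
    · filter_upwards with t
      nlinarith [sq_nonneg (e t + I t), sq_nonneg (e t - I t)]
    · refine hd.of_le (2 * M) ?_
      filter_upwards with t
      rw [norm_mul, norm_mul, Real.norm_eq_abs, Real.norm_eq_abs, Real.norm_eq_abs, abs_abs,
        abs_of_nonneg hM, abs_two, Real.norm_eq_abs]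
    · filter_upwards [hk₁, hk₂, ha, hbe, hbI] with t h1 h2 h3 h4 h5
      have hq := hquad (e t ^ 2) (I t ^ 2) (e t * I t) (sq_nonneg _) (sq_nonneg _)
        (by rw [mul_pow])
      have b1 : κ * e t ^ 2 ≤ k₁ t * e t ^ 2 := by gcongr; exact h1.1
      have hk2 : 0 ≤ k₂ t := hκ.le.trans h2.1
      have b2 : 0 ≤ k₂ t * k₃ * (1 - a t) * I t ^ 2 :=
        mul_nonneg (mul_nonneg (mul_nonneg hk2 hk₃.le) (by linarith)) (sq_nonneg _)
      have b3 : |(-k₁ t - k₂ t * k₃ * (1 - a t)) * (e t * I t)| ≤ (K + K * k₃) * |e t * I t| := by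
        rw [abs_mul]
        gcongr
        rw [abs_le]
        have : k₂ t * k₃ * (1 - a t) ≤ K * k₃ * 1 := by
          gcongr
          · linarith
          · exact h2.2
          · linarith
        have : 0 ≤ k₂ t * k₃ * (1 - a t) := mul_nonneg (mul_nonneg hk2 hk₃.le) (by linarith)
        constructor <;> linarith
      have b3' := (le_abs_self _).trans b3
      have b4 : κ ^ 2 * I t ^ 2 ≤ k₂ t * a t * I t ^ 2 := by
        have : κ * κ ≤ k₂ t * a t := mul_le_mul h2.1 h3.1 hκ.le hk2
        rw [pow_two]
        gcongr
      have b5 : k₂ t * a t * e t ^ 2 ≤ K * e t ^ 2 := by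
        gcongr
        calc k₂ t * a t ≤ k₂ t * 1 := by gcongr; exact h3.2
          _ ≤ K := by linarith
      have b6 : d t * (e t + η * I t) ≤ 2 * M * |d t| := by
        refine (le_abs_self _).trans ?_
        rw [abs_mul, mul_comm]
        gcongr
        refine (abs_add_le _ _).trans ?_
        rw [abs_mul, abs_of_pos hη]
        nlinarith [abs_nonneg (I t)]
      have b7 : c * ((e t ^ 2 + I t ^ 2) / 2 + η * (e t * I t)) ≤ c * (e t ^ 2 + I t ^ 2) := by
        refine mul_le_mul_of_nonneg_left ?_ hc.le
        nlinarith [sq_nonneg (e t + I t), sq_nonneg (e t - I t)]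
      have b8 := mul_le_mul_of_nonneg_left
        (show (-k₁ t - k₂ t * k₃ * (1 - a t)) * (e t * I t) - k₂ t * a t * I t ^ 2
          + k₂ t * a t * e t ^ 2 ≤ K * e t ^ 2 + (K + K * k₃) * |e t * I t| - κ ^ 2 * I t ^ 2 by
            linarith) hη.le
      linarith
  have hlow : ∀ t, e t ^ 2 + I t ^ 2 ≤ 4 * ‖(e t ^ 2 + I t ^ 2) / 2 + η * (e t * I t)‖ := by
    intro t
    have := Real.le_norm_self ((e t ^ 2 + I t ^ 2) / 2 + η * (e t * I t))
    nlinarith [sq_nonneg (e t + I t), sq_nonneg (e t - I t)]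
  constructor
  · refine key.of_sq_le 4 (Eventually.of_forall fun t => ?_)
    rw [Real.norm_eq_abs, sq_abs]
    linarith [hlow t, sq_nonneg (I t)]
  · refine key.of_sq_le 4 (Eventually.of_forall fun t => ?_)
    rw [Real.norm_eq_abs, sq_abs]
    linarith [hlow t, sq_nonneg (e t)]

/-! ### Heading control -/

/-- Decrease of the Lyapunov function of the heading loop. -/
theorem heading_lyapunov_deriv_le {c n x a e₁ e₂ k₁ k₂ k₃ κ κ' η M : ℝ} (hk₁ : 0 < k₁)
    (hk₂ : 0 < k₂) (hk₃ : 0 < k₃) (hκ : 0 < κ) (hM : 0 ≤ M) (hη : 0 ≤ η) (hη1 : η ≤ 1 / 2)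
    (hquad : ∀ S N x : ℝ, 0 ≤ S → 0 ≤ N → x ^ 2 ≤ S * N →
      -k₁ * S + η * ((k₁ * (M + 1) + 2 * (k₂ * M) + 1) * S + (k₁ + k₃) * |x| - k₂ * κ * N)
        ≤ -κ' * (S + N))
    (ha : κ ≤ a ∧ a ≤ 1) (hc1 : |c| ≤ 1) (hn0 : 0 ≤ n) (hnM : n ≤ M)
    (hxn : x ^ 2 ≤ (1 - c ^ 2) * n) (hxX : |x| ≤ M + 1) :
    -k₁ * (1 - c ^ 2) - k₂ * k₃ * (1 - a) * n - e₁ +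
        η * ((k₁ * (1 - c ^ 2) + k₂ * a * x + e₁) * x + c * (-c * k₁ * x
        - c * k₂ * a * n - k₃ * (1 - a) * x + a * (1 - c ^ 2) + e₂))
      ≤ -(κ' * (1 - c ^ 2 + n)) + ((1 + (M + 1)) * |e₁| + |e₂|) := by
  set X := M + 1 with hX
  set S := 1 - c ^ 2 with hSdef
  have hS0 : 0 ≤ S := sub_nonneg.2 ((sq_le_one_iff_abs_le_one c).2 hc1)
  have hq := hquad (S) (n) (x) hS0 hn0 hxn
  have ha0 : 0 ≤ a := hκ.le.trans ha.1
  have hX0 : 0 ≤ X := by positivity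
  have b1 : 0 ≤ k₂ * k₃ * (1 - a) * n :=
    mul_nonneg (mul_nonneg (by positivity) (by linarith)) hn0
  have b2 : k₁ * S * x ≤ k₁ * X * S := by
    have := mul_le_mul_of_nonneg_left ((le_abs_self _).trans hxX) (mul_nonneg hk₁.le hS0)
    linarith
  have b3 : k₂ * a * x ^ 2 ≤ k₂ * M * S := by
    have h1 : a * x ^ 2 ≤ 1 * (S * n) :=
      mul_le_mul ha.2 hxn (sq_nonneg _) one_pos.le
    have h2 : S * n ≤ S * M := by gcongr
    have h3 := mul_le_mul_of_nonneg_left (h1.trans (by linarith : 1 * (S * n) ≤ S * M)) hk₂.le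
    linarith
  have b4 : c * (-c * k₁ * x - k₃ * (1 - a) * x) ≤ (k₁ + k₃) * |x| := by
    have h1 : c * (-c * k₁ * x - k₃ * (1 - a) * x)
        = c * (-c * k₁ - k₃ * (1 - a)) * x := by ring
    rw [h1]
    refine (le_abs_self _).trans ?_
    rw [abs_mul, abs_mul]
    gcongr
    have h2 : |-c * k₁ - k₃ * (1 - a)| ≤ k₁ + k₃ := by
      refine (abs_sub _ _).trans ?_
      rw [abs_mul, abs_neg, abs_mul, abs_of_pos hk₁, abs_of_pos hk₃,
        abs_of_nonneg (by linarith : 0 ≤ 1 - a)]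
      nlinarith
    calc |c| * |-c * k₁ - k₃ * (1 - a)| ≤ 1 * (k₁ + k₃) :=
        mul_le_mul hc1 h2 (abs_nonneg _) one_pos.le
      _ = k₁ + k₃ := one_mul _
  -- The cross term damps `n` only with the factor `c²`. Since `c² = 1 - S`, the missing part is at
  -- most `k₂ M S`, which the damping of `S` can pay for.
  have b5 : -(c ^ 2 * k₂ * a * n) ≤ -(k₂ * κ * n) + k₂ * M * S := by
    have h1 : κ * n ≤ a * n := by gcongr; exact ha.1
    have h2 : S * (a * n) ≤ S * (1 * M) := by gcongr; exact ha.2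
    have h3 : c ^ 2 = 1 - S := by rw [hSdef]; ring
    rw [h3]
    have h4 := mul_le_mul_of_nonneg_left h1 hk₂.le
    have h5 := mul_le_mul_of_nonneg_left h2 hk₂.le
    linarith
  have b6 : c * (a * S) ≤ S := by
    have h1 : c ≤ 1 := (le_abs_self _).trans hc1
    have h2 : a * S ≤ 1 * S := by gcongr; exact ha.2
    have h3 : 0 ≤ a * S := mul_nonneg ha0 hS0
    nlinarith
  have b7 : -e₁ + η * (e₁ * x + c * e₂) ≤ (1 + X) * |e₁| + |e₂| := by
    have h1 : e₁ * x ≤ X * |e₁| := by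
      refine (le_abs_self _).trans ?_
      rw [abs_mul, mul_comm]; gcongr
    have h2 : c * e₂ ≤ |e₂| := by
      refine (le_abs_self _).trans ?_
      rw [abs_mul]
      exact (mul_le_mul_of_nonneg_right hc1 (abs_nonneg _)).trans (one_mul _).le
    have h3 := neg_abs_le (e₁)
    have h4 : 0 ≤ X * |e₁| + |e₂| := by positivity
    nlinarith
  have b8 := mul_le_mul_of_nonneg_left
    (show k₁ * S * x + k₂ * a * x ^ 2 + c * (-c * k₁ * x - k₃ * (1 - a) * x)
      - c ^ 2 * k₂ * a * n + c * (a * S) ≤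
        (k₁ * X + 2 * (k₂ * M) + 1) * S + (k₁ + k₃) * |x| - k₂ * κ * n by linarith) hη
  linarith

/-- The Lyapunov function of the heading loop is comparable to its dominant part. -/
theorem heading_lyapunov_bounds {c n x k₂ η : ℝ} (hη : 0 ≤ η) (hη1 : η ≤ 1 / 2)
    (hη2 : η ≤ k₂ / 2) (hc1 : |c| ≤ 1) (hn0 : 0 ≤ n) (hxn : x ^ 2 ≤ (1 - c ^ 2) * n) :
    (1 - c + k₂ / 2 * n) / 2 ≤ 1 - c + k₂ / 2 * n + η * (c * x) ∧
      1 - c + k₂ / 2 * n + η * (c * x) ≤ 2 * (1 - c + k₂ / 2 * n) := by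
  have hS : 0 ≤ 1 - c ^ 2 := sub_nonneg.2 ((sq_le_one_iff_abs_le_one c).2 hc1)
  have hc := (abs_le.1 hc1).2
  have h1 : |x| ≤ (1 - c ^ 2 + n) / 2 := by
    refine abs_le_of_sq_le_sq ?_ (by linarith)
    nlinarith [sq_nonneg (1 - c ^ 2 - n)]
  have h2 : 1 - c ^ 2 ≤ 2 * (1 - c) := by nlinarith [sq_nonneg (1 - c)]
  have h3 : |η * (c * x)| ≤ (1 - c + k₂ / 2 * n) / 2 := by
    rw [abs_mul, abs_mul, abs_of_nonneg hη]
    have h4 : |c| * |x| ≤ (1 - c) + n / 2 :=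
      (mul_le_of_le_one_left (abs_nonneg x) hc1).trans (by linarith)
    have h5 := mul_le_mul_of_nonneg_left h4 hη
    nlinarith
  have h4 := abs_le.1 h3
  have h5 := abs_nonneg (η * (c * x))
  constructor <;> linarith

set_option maxHeartbeats 400000 in
/-- The heading loop in terms of the cosine `c` of the heading error, the squared norm `n` of the
integrator, and their correlation `x`: either the unstable equilibrium is reached asymptotically,
or the stable one is reached exponentially. -/
theorem heading_loop_scalar {c n x a e₁ e₂ : ℝ → ℝ} {k₁ k₂ k₃ κ M : ℝ} (hk₁ : 0 < k₁)
    (hk₂ : 0 < k₂) (hk₃ : 0 < k₃) (hκ : 0 < κ)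
    (hc : ∀ᶠ t in atTop, HasDerivAt c (k₁ * (1 - c t ^ 2) + k₂ * a t * x t + e₁ t) t)
    (hn : ∀ᶠ t in atTop, HasDerivAt n (2 * (-k₃ * (1 - a t) * n t + a t * x t)) t)
    (hx : ∀ᶠ t in atTop, HasDerivAt x (-c t * k₁ * x t - c t * k₂ * a t * n t
      - k₃ * (1 - a t) * x t + a t * (1 - c t ^ 2) + e₂ t) t)
    (ha : ∀ᶠ t in atTop, κ ≤ a t ∧ a t ≤ 1)
    (hc1 : ∀ᶠ t in atTop, |c t| ≤ 1) (hn0 : ∀ᶠ t in atTop, 0 ≤ n t)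
    (hnM : ∀ᶠ t in atTop, n t ≤ M) (hxn : ∀ᶠ t in atTop, x t ^ 2 ≤ (1 - c t ^ 2) * n t)
    (he₁ : TendsToZeroUltExp e₁) (he₂ : TendsToZeroUltExp e₂) :
    (Tendsto c atTop (𝓝 (-1)) ∧ Tendsto n atTop (𝓝 0)) ∨
      (TendsToZeroUltExp (fun t => 1 - c t) ∧ TendsToZeroUltExp n) := by
  have hM : 0 ≤ M := by
    obtain ⟨t, h1, h2⟩ := (hn0.and hnM).exists
    exact h1.trans h2
  have hS : ∀ᶠ t in atTop, 0 ≤ 1 - c t ^ 2 ∧ 1 - c t ^ 2 ≤ 1 := by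
    filter_upwards [hc1] with t ht
    have := (sq_le_one_iff_abs_le_one (c t)).2 ht
    constructor <;> nlinarith [sq_nonneg (c t)]
  set X := M + 1 with hX
  have hxX : ∀ᶠ t in atTop, |x t| ≤ X := by
    filter_upwards [hxn, hn0, hnM, hS] with t h1 h2 h3 h4
    refine abs_le_of_sq_le_sq (b := X) ?_ (by positivity)
    nlinarith
  obtain ⟨η, κ', hη, hη', hκ', hquad⟩ := exists_cross_term_weight (a := k₁)
    (A := k₁ * X + 2 * (k₂ * M) + 1) (B := k₂ * κ) (L := k₁ + k₃)
    (η₀ := min (1 / 2) (k₂ / 2)) hk₁ (by positivity) (by positivity) (by positivity)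
  have hη1 : η ≤ 1 / 2 := hη'.trans (min_le_left _ _)
  have hη2 : η ≤ k₂ / 2 := hη'.trans (min_le_right _ _)
  set V : ℝ → ℝ := fun t => (1 - c t) + k₂ / 2 * n t with hV
  -- The damping of `n` in `V` fades as `a` approaches `1`. The derivative of `x` contains `-c k₂ a
  -- n`, whose sign depends on that of `c`; the extra factor `c` yields damping near both equilibria
  -- `c = ±1`.
  set W : ℝ → ℝ := fun t => V t + η * (c t * x t) with hW
  set S : ℝ → ℝ := fun t => 1 - c t ^ 2 with hSdef
  have hVd : ∀ᶠ t in atTop, HasDerivAt V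
      (-k₁ * S t - k₂ * k₃ * (1 - a t) * n t - e₁ t) t := by
    filter_upwards [hc, hn] with t h1 h2
    refine ((h1.const_sub 1).add (h2.const_mul (k₂ / 2))).congr_deriv ?_
    simp only [hSdef]
    ring
  have hWd : ∀ᶠ t in atTop, HasDerivAt W
      (-k₁ * S t - k₂ * k₃ * (1 - a t) * n t - e₁ t +
        η * ((k₁ * S t + k₂ * a t * x t + e₁ t) * x t + c t * (-c t * k₁ * x t
        - c t * k₂ * a t * n t - k₃ * (1 - a t) * x t + a t * S t + e₂ t))) t := by
    filter_upwards [hVd, hc, hx] with t h1 h2 h3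
    exact h1.add ((h2.mul h3).const_mul η)
  have hWle : ∀ᶠ t in atTop,
      -k₁ * S t - k₂ * k₃ * (1 - a t) * n t - e₁ t +
        η * ((k₁ * S t + k₂ * a t * x t + e₁ t) * x t + c t * (-c t * k₁ * x t
        - c t * k₂ * a t * n t - k₃ * (1 - a t) * x t + a t * S t + e₂ t))
      ≤ -(κ' * (S t + n t)) + ((1 + X) * |e₁ t| + |e₂ t|) := by
    filter_upwards [ha, hc1, hn0, hnM, hxn, hS, hxX] with t ha hc1 hn0 hnM hxn hS hxX
    exact heading_lyapunov_deriv_le hk₁ hk₂ hk₃ hκ hM hη.le hη1 hquad ha hc1 hn0 hnM hxn hxX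
  have hVW : ∀ᶠ t in atTop, V t / 2 ≤ W t ∧ W t ≤ 2 * V t := by
    filter_upwards [hc1, hn0, hxn] with t hc1 hn0 hxn
    exact heading_lyapunov_bounds hη.le hη1 hη2 hc1 hn0 hxn
  have hV0 : ∀ᶠ t in atTop, 0 ≤ V t := by
    filter_upwards [hc1, hn0] with t h1 h2
    have := (abs_le.1 h1).2
    simp only [hV]
    have : 0 ≤ k₂ / 2 * n t := by positivity
    linarith
  have herr : TendsToZeroUltExp (fun t => (1 + X) * |e₁ t| + |e₂ t|) := by
    refine TendsToZeroUltExp.add (he₁.of_le (1 + X) ?_) he₂.norm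
    filter_upwards with t
    rw [norm_mul, Real.norm_eq_abs, Real.norm_eq_abs, Real.norm_eq_abs, abs_abs,
      abs_of_nonneg (by positivity)]
  -- Barbalat's lemma; the constant `L` adds up bounds on all terms of the derivative, with `|e₁| ≤
  -- 1` eventually.
  have hnlim : Tendsto (fun t => κ' * (S t + n t)) atTop (𝓝 0) := by
    refine tendsto_zero_of_deriv_le_neg (B := 0) (L := κ' * (2 * (k₁ + k₂ * X + 1) +
      2 * (k₃ * M + X))) hWd ?_ (f' := fun t => κ' *
      (-(2 * c t * (k₁ * (1 - c t ^ 2) + k₂ * a t * x t + e₁ t)) +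
        2 * (-k₃ * (1 - a t) * n t + a t * x t))) ?_ ?_ ?_ herr hWle
    · filter_upwards [hVW, hV0] with t h1 h2
      linarith
    · filter_upwards [hc, hn] with t h1 h2
      refine ((((h1.pow 2).const_sub 1).add h2).const_mul κ').congr_deriv ?_
      simp
    · filter_upwards [ha, hc1, hn0, hnM, hS, hxX, he₁.eventually_norm_le one_pos] with
        t ha hc1 hn0 hnM hS hxX he
      have ha0 : 0 ≤ a t := hκ.le.trans ha.1
      have hax : |a t * x t| ≤ X := by
        rw [abs_mul, abs_of_nonneg ha0]
        calc a t * |x t| ≤ 1 * X := mul_le_mul ha.2 hxX (abs_nonneg _) one_pos.le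
          _ = X := one_mul _
      have d1 : |k₁ * (1 - c t ^ 2) + k₂ * a t * x t + e₁ t| ≤ k₁ + k₂ * X + 1 := by
        refine (abs_add_le _ _).trans (add_le_add ((abs_add_le _ _).trans (add_le_add ?_ ?_)) he)
        · rw [abs_mul, abs_of_pos hk₁, abs_of_nonneg hS.1]
          nlinarith [hS.2]
        · rw [mul_assoc, abs_mul, abs_of_pos hk₂]
          gcongr
      have d2 : |-k₃ * (1 - a t) * n t + a t * x t| ≤ k₃ * M + X := by
        refine (abs_add_le _ _).trans (add_le_add ?_ hax)
        rw [abs_mul, abs_mul, abs_neg, abs_of_pos hk₃, abs_of_nonneg hn0,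
          abs_of_nonneg (by linarith : 0 ≤ 1 - a t), mul_assoc]
        gcongr
        calc (1 - a t) * n t ≤ 1 * M := mul_le_mul (by linarith) hnM hn0 one_pos.le
          _ = M := one_mul _
      rw [abs_mul, abs_of_pos hκ']
      gcongr
      refine (abs_add_le _ _).trans (add_le_add ?_ ?_)
      · rw [abs_neg, abs_mul, abs_mul, abs_two, mul_assoc]
        gcongr
        calc _ ≤ 1 * (k₁ + k₂ * X + 1) := mul_le_mul hc1 d1 (abs_nonneg _) one_pos.le
          _ = _ := one_mul _
      · rw [abs_mul, abs_two]
        gcongr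
    · filter_upwards [hS, hn0] with t h1 h2
      exact mul_nonneg hκ'.le (add_nonneg h1.1 h2)
  have hn_lim : Tendsto n atTop (𝓝 0) := by
    have h1 : Tendsto (fun t => S t + n t) atTop (𝓝 0) := by
      have := hnlim.const_mul κ'⁻¹
      simpa [← mul_assoc, inv_mul_cancel₀ hκ'.ne'] using this
    refine squeeze_zero' hn0 ?_ h1
    filter_upwards [hS] with t ht
    linarith [ht.1]
  by_cases hcl : Tendsto c atTop (𝓝 (-1))
  · exact Or.inl ⟨hcl, hn_lim⟩
  right
  -- `V` is nonincreasing up to a vanishing correction, so `c` stays away from `-1`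
  obtain ⟨δ, hδ, hδc⟩ : ∃ δ > 0, ∃ᶠ t in atTop, -1 + δ ≤ c t := by
    by_contra! hcon
    refine hcl (Metric.tendsto_nhds.2 fun δ hδ => ?_)
    filter_upwards [hcon δ hδ, hc1] with t h1 h2
    rw [Real.dist_eq, abs_lt]
    have := (abs_le.1 h2).1
    constructor <;> linarith
  obtain ⟨ζ, ζ', hζ, hζ0, hζd⟩ := exists_antitone_correction (f := fun _ => 0) hVd he₁.norm (by
    filter_upwards [hS, ha, hn0] with t h1 h2 h3
    have b1 : 0 ≤ k₂ * k₃ * (1 - a t) * n t :=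
      mul_nonneg (mul_nonneg (by positivity) (by linarith)) h3
    have b2 : 0 ≤ k₁ * S t := mul_nonneg hk₁.le h1.1
    have := neg_abs_le (e₁ t)
    rw [Real.norm_eq_abs]
    linarith)
  obtain ⟨T, hT⟩ := eventually_atTop.1 (hζ0.and (hζd.and hn0))
  have hanti := antitoneOn_Ici_of_hasDerivAt (fun t ht => (hT t ht).2.1.1)
    (fun t ht => by simpa using (hT t ht).2.1.2)
  have hsmall : ∀ᶠ t in atTop, k₂ / 2 * n t + ζ t ≤ δ / 2 := by
    have h1 : Tendsto (fun t => k₂ / 2 * n t + ζ t) atTop (𝓝 0) := by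
      simpa using (hn_lim.const_mul (k₂ / 2)).add hζ.tendsto
    filter_upwards [h1.eventually (gt_mem_nhds (half_pos hδ))] with t ht using ht.le
  -- At this time `V + ζ ≤ 2 - δ + δ / 2`, and this bound persists, which forces `c ≥ -1 + δ / 2`
  -- from then on.
  obtain ⟨T₁, hT₁, hc₁, hs₁⟩ :=
    (hδc.and_eventually (hsmall.and (eventually_ge_atTop T))).exists
  have hclow : ∀ᶠ t in atTop, -1 + δ / 2 ≤ c t := by
    filter_upwards [eventually_ge_atTop T₁] with t ht
    have h1 := hanti (mem_Ici.2 hs₁) (mem_Ici.2 (hs₁.trans ht)) ht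
    have h2 := hT t (hs₁.trans ht)
    have h3 : 0 ≤ k₂ / 2 * n t := mul_nonneg (by positivity) h2.2.2
    simp only [hV] at h1
    linarith [h2.1]
  -- As `1 + c ≥ δ / 2`, the factorization `S = (1 + c)(1 - c)` gives `S + n ≥ min (δ / 2) (2 / k₂)
  -- * V`; the final division by `2` comes from `W ≤ 2 V`.
  set κ₂ := κ' * min (δ / 2) (2 / k₂) / 2 with hκ₂
  have hmin : 0 < min (δ / 2) (2 / k₂) := by positivity
  have hWexp : TendsToZeroUltExp W := by
    refine TendsToZeroUltExp.of_deriv_le (c := κ₂) (by positivity) hWd ?_ herr ?_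
    · filter_upwards [hVW, hV0] with t h1 h2
      linarith
    · filter_upwards [hWle, hVW, hclow, hn0, hc1] with t h1 h2 h3 h4 h5
      refine h1.trans (add_le_add_left ?_ _)
      have h6 := (abs_le.1 h5).2
      have h7 : min (δ / 2) (2 / k₂) * V t ≤ S t + n t := by
        have e1 : min (δ / 2) (2 / k₂) * (1 - c t) ≤ (1 + c t) * (1 - c t) := by
          refine mul_le_mul_of_nonneg_right ?_ (by linarith)
          exact (min_le_left _ _).trans (by linarith)
        have e2 : min (δ / 2) (2 / k₂) * (k₂ / 2 * n t) ≤ 2 / k₂ * (k₂ / 2 * n t) :=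
          mul_le_mul_of_nonneg_right (min_le_right _ _) (by positivity)
        have e3 : 2 / k₂ * (k₂ / 2 * n t) = n t := by field_simp
        simp only [hV, hSdef]
        linarith
      have h8 : κ₂ * W t ≤ κ₂ * (2 * V t) := mul_le_mul_of_nonneg_left h2.2 (by positivity)
      have h9 := mul_le_mul_of_nonneg_left h7 hκ'.le
      have h10 : κ₂ * (2 * V t) = κ' * (min (δ / 2) (2 / k₂) * V t) := by rw [hκ₂]; ring
      linarith
  have hVexp : TendsToZeroUltExp V := by
    refine hWexp.of_le 2 ?_
    filter_upwards [hVW, hV0] with t h1 h2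
    rw [Real.norm_eq_abs, abs_of_nonneg h2]
    linarith [Real.le_norm_self (W t)]
  constructor
  · refine hVexp.of_le 1 ?_
    filter_upwards [hc1, hn0] with t h1 h2
    have := (abs_le.1 h1).2
    rw [Real.norm_eq_abs, abs_of_nonneg (by linarith)]
    have : 0 ≤ k₂ / 2 * n t := by positivity
    have := Real.le_norm_self (V t)
    simp only [hV] at this ⊢
    linarith
  · refine hVexp.of_le (2 / k₂) ?_
    filter_upwards [hc1, hn0] with t h1 h2
    have := (abs_le.1 h1).2
    have h3 := Real.le_norm_self (V t)
    rw [Real.norm_eq_abs, abs_of_nonneg h2, div_mul_eq_mul_div, le_div_iff₀ hk₂]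
    simp only [hV] at h3 ⊢
    linarith

/-- Asymptotic behaviour of the heading under the proportional-integral heading control, up to
an exponentially decaying perturbation. -/
theorem heading_loop {α : ℝ → ℝ → ℝ} (hα : IsSaturationFamily α) {Δ k₁ k₂ k₃ : ℝ} (hΔ : 0 < Δ)
    (hk₁ : 0 < k₁) (hk₂ : 0 < k₂) (hk₃ : 0 < k₃) {h hs z ω ε : ℝ → E3}
    (hh : ∀ t ≥ 0, ‖h t‖ = 1) (hhs : ∀ t ≥ 0, ‖hs t‖ = 1)
    (dh : ∀ᶠ t in atTop, HasDerivAt h (cross (ω t + k₁ • cross (h t) (hs t) +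
      (k₂ * α Δ ‖z t + (1 / k₃) • cross (h t) (hs t)‖) • z t) (h t) + ε t) t)
    (dhs : ∀ t > 0, HasDerivAt hs (cross (ω t) (hs t)) t)
    (dz : ∀ t > 0, HasDerivAt z (cross (ω t) (z t) +
      k₃ • (-z t + sat α Δ (z t + (1 / k₃) • cross (h t) (hs t)))) t)
    (hz0 : z 0 = 0) (cz : ContinuousOn z (Ici 0)) (chs : ContinuousOn hs (Ici 0))
    (hε : TendsToZeroUltExp ε) :
    (Tendsto (fun t => h t + hs t) atTop (𝓝 0) ∧ Tendsto z atTop (𝓝 0)) ∨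
      (TendsToZeroUltExp (fun t => h t - hs t) ∧ TendsToZeroUltExp z) := by
  set ht : ℝ → E3 := fun t => cross (h t) (hs t) with hht
  set a : ℝ → ℝ := fun t => α Δ ‖z t + (1 / k₃) • ht t‖ with ha
  have ha0 : ∀ t, 0 < a t := fun t => hα.pos Δ hΔ _ (norm_nonneg _)
  have ha1 : ∀ t, a t ≤ 1 := fun t => hα.le_one hΔ (norm_nonneg _)
  have dz' : ∀ t > 0, HasDerivAt z (cross (ω t) (z t) + ((-k₃ * (1 - a t)) • z t + a t • ht t)) t := by
    intro t h0
    refine (dz t h0).congr_deriv ?_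
    congr 1
    have e : sat α Δ (z t + (1 / k₃) • ht t) = a t • (z t + (1 / k₃) • ht t) := rfl
    rw [e]
    match_scalars <;> field_simp
    ring
  have dn : ∀ t > 0, HasDerivAt (fun t => ‖z t‖ ^ 2)
      (2 * (-k₃ * (1 - a t) * ‖z t‖ ^ 2 + a t * ⟪ht t, z t⟫)) t := by
    intro t h0
    refine (dz' t h0).norm_sq.congr_deriv ?_
    rw [inner_add_right, real_inner_comm, inner_cross_self_right, inner_add_right,
      real_inner_smul_right, real_inner_smul_right, real_inner_self_eq_norm_sq,
      real_inner_comm (ht t) (z t)]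
    ring
  -- Both vectors are carried by `ω`, and `h × h*` is orthogonal to `h*`, so `⟪z, h*⟫` solves a
  -- homogeneous linear equation with nonpositive coefficient and zero initial value. This later
  -- removes a term from the derivative of `x`.
  have hzhs : ∀ t ≥ 0, ⟪z t, hs t⟫ = 0 := by
    have hanti : AntitoneOn (fun t => ⟪z t, hs t⟫ ^ 2) (Ici 0) := by
      refine antitoneOn_of_hasDerivWithinAt_nonpos (convex_Ici 0) ((cz.inner chs).pow 2)
        (f' := fun t => 2 * ⟪z t, hs t⟫ * (-k₃ * (1 - a t) * ⟪z t, hs t⟫)) ?_ ?_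
      · intro t h0
        have h0 : 0 < t := by simpa using h0
        have h1 := ((dz' t h0).inner ℝ (dhs t h0)).pow 2
        refine (h1.congr_deriv ?_).hasDerivWithinAt
        simp only [inner_add_left, real_inner_smul_left]
        have e1 : ⟪ht t, hs t⟫ = 0 := inner_cross_self_right _ _
        have e2 := inner_cross_add_inner_cross (ω t) (ω t) (z t) (hs t)
        rw [sub_self, inner_zero_left] at e2
        rw [e1]
        push_cast
        rw [pow_one]
        linear_combination 2 * ⟪z t, hs t⟫ * e2
      · intro t _
        have : 0 ≤ k₃ * (1 - a t) := mul_nonneg hk₃.le (by linarith [ha1 t])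
        nlinarith [mul_nonneg this (sq_nonneg ⟪z t, hs t⟫)]
    intro t h0
    have := hanti (mem_Ici.2 le_rfl) h0 h0
    simp only [hz0, inner_zero_left] at this
    exact pow_eq_zero_iff two_ne_zero |>.1 (le_antisymm (by simpa using this) (sq_nonneg _))
  have hhtn : ∀ t ≥ 0, ‖ht t‖ ^ 2 = 1 - ⟪h t, hs t⟫ ^ 2 := by
    intro t h0
    rw [hht, norm_cross_sq, hh t h0, hhs t h0]; ring
  have hht1 : ∀ t ≥ 0, ‖ht t‖ ≤ 1 := by
    intro t h0
    simpa [hh t h0, hhs t h0] using norm_cross_le (h t) (hs t)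
  -- The saturated term has norm at most `Δ`, so the leakage `-z` dominates as soon as `‖z‖ ≥ Δ`.
  obtain ⟨M, hM⟩ : ∃ M, ∀ᶠ t in atTop, ‖z t‖ ^ 2 ≤ M := by
    refine eventually_le_of_deriv_nonpos_above (Δ ^ 2)
      (by filter_upwards [eventually_gt_atTop 0] with t h0 using dn t h0) ?_
    filter_upwards with t hB
    have hz : Δ ≤ ‖z t‖ := abs_le_of_sq_le_sq hB (norm_nonneg _) |> (le_abs_self Δ).trans
    have e : -k₃ * (1 - a t) * ‖z t‖ ^ 2 + a t * ⟪ht t, z t⟫ =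
        k₃ * (⟪sat α Δ (z t + (1 / k₃) • ht t), z t⟫ - ‖z t‖ ^ 2) := by
      have : sat α Δ (z t + (1 / k₃) • ht t) = a t • (z t + (1 / k₃) • ht t) := rfl
      rw [this, real_inner_smul_left, inner_add_left, real_inner_smul_left,
        real_inner_self_eq_norm_sq]
      field_simp
      ring
    rw [e]
    have h1 : ⟪sat α Δ (z t + (1 / k₃) • ht t), z t⟫ ≤ Δ * ‖z t‖ :=
      (real_inner_le_norm _ _).trans (by gcongr; exact hα.norm_sat_le hΔ _)
    have h2 : ⟪sat α Δ (z t + (1 / k₃) • ht t), z t⟫ - ‖z t‖ ^ 2 ≤ 0 := by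
      nlinarith [norm_nonneg (z t)]
    have := mul_nonpos_of_nonneg_of_nonpos hk₃.le h2
    linarith
  have hzM : ∀ᶠ t in atTop, ‖z t‖ ≤ √M := by
    filter_upwards [hM] with t h1 using Real.le_sqrt_of_sq_le h1
  -- `κ` is the value of the decreasing function `α Δ` at the largest argument allowed by `‖z‖ ≤ √M`
  -- and `‖h × h*‖ ≤ 1`.
  have hloop := heading_loop_scalar (c := fun t => ⟪h t, hs t⟫) (n := fun t => ‖z t‖ ^ 2)
    (x := fun t => ⟪ht t, z t⟫) (a := a) (e₁ := fun t => ⟪ε t, hs t⟫)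
    (e₂ := fun t => ⟪cross (ε t) (hs t), z t⟫) (κ := α Δ (√M + 1 / k₃)) (M := M)
    hk₁ hk₂ hk₃ (hα.pos Δ hΔ _ (by positivity)) ?_ ?_ ?_ ?_ ?_ ?_ hM ?_ ?_ ?_
  · rcases hloop with ⟨h1, h2⟩ | ⟨h1, h2⟩
    · left
      constructor
      · rw [tendsto_zero_iff_norm_tendsto_zero]
        have h3 : Tendsto (fun t => √(2 * (1 + ⟪h t, hs t⟫))) atTop (𝓝 0) := by
          have := ((h1.const_add 1).const_mul 2).sqrt
          simpa using this
        refine h3.congr' ?_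
        filter_upwards [eventually_ge_atTop 0] with t h0
        rw [← Real.sqrt_sq (norm_nonneg (h t + hs t)), norm_add_sq_real, hh t h0, hhs t h0]
        congr 1
        ring
      · rw [tendsto_zero_iff_norm_tendsto_zero]
        have := h2.sqrt
        simpa using this
    · right
      constructor
      · refine h1.of_sq_le 2 ?_
        filter_upwards [eventually_ge_atTop 0] with t h0
        rw [norm_sub_sq_of_unit (hh t h0) (hhs t h0)]
        gcongr
        exact Real.le_norm_self _
      · refine h2.of_sq_le 1 ?_
        filter_upwards with t
        rw [one_mul]
        exact Real.le_norm_self _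
  · filter_upwards [dh, eventually_gt_atTop 0] with t h1 h0
    refine (h1.inner ℝ (dhs t h0)).congr_deriv ?_
    simp only [inner_add_left]
    have e := inner_cross_add_inner_cross (ω t + k₁ • ht t + (k₂ * a t) • z t) (ω t) (h t) (hs t)
    have e1 := hhtn t h0.le
    rw [← real_inner_self_eq_norm_sq] at e1
    rw [add_assoc (ω t), add_sub_cancel_left, inner_add_left, real_inner_smul_left,
      real_inner_smul_left] at e
    change _ = k₁ * ⟪ht t, ht t⟫ + k₂ * a t * ⟪z t, ht t⟫ at e
    rw [e1, real_inner_comm (ht t) (z t)] at e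
    rw [← e, add_assoc (ω t)]
    simp only [hht]
    ring
  · filter_upwards [eventually_gt_atTop 0] with t h0 using dn t h0
  · filter_upwards [dh, eventually_gt_atTop 0] with t h1 h0
    have hd := hasDerivAt_cross h1 (dhs t h0)
    refine (hd.inner ℝ (dz' t h0)).congr_deriv ?_
    -- `b` is the feedback part of the angular velocity. By the Jacobi identity, `ω` merely rotates
    -- `h × h*`, and `b` acts through a double product that reduces to `-⟪h, h*⟫ b`, because `b` is
    -- orthogonal to `h*`.
    set b : E3 := k₁ • ht t + (k₂ * a t) • z t with hb
    have e1 : cross (cross (ω t + k₁ • cross (h t) (hs t) + (k₂ * a t) • z t) (h t) + ε t) (hs t)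
        + cross (h t) (cross (ω t) (hs t)) =
        cross (ω t) (ht t) + (⟪b, hs t⟫ • h t - ⟪h t, hs t⟫ • b) + cross (ε t) (hs t) := by
      rw [add_assoc (ω t), cross_add_left, cross_add_left, cross_add_left, cross_cross b,
        show cross (ω t) (ht t) = _ from (cross_jacobi (ω t) (h t) (hs t)).symm]
      abel
    have e2 : ⟪b, hs t⟫ = 0 := by
      rw [hb, inner_add_left, real_inner_smul_left, real_inner_smul_left, hzhs t h0.le]
      simp [hht, inner_cross_self_right]
    have e3 := inner_cross_add_inner_cross (ω t) (ω t) (ht t) (z t)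
    rw [sub_self, inner_zero_left] at e3
    have e4 : ⟪ht t, ht t⟫ = 1 - ⟪h t, hs t⟫ ^ 2 := by
      rw [real_inner_self_eq_norm_sq, hhtn t h0.le]
    change ⟪ht t, cross (ω t) (z t) + _⟫ + ⟪cross (cross (ω t + k₁ • cross (h t) (hs t) +
      (k₂ * a t) • z t) (h t) + ε t) (hs t) + cross (h t) (cross (ω t) (hs t)), z t⟫ = _
    rw [e1, e2]
    simp only [hb, inner_add_left, inner_add_right, zero_smul, inner_sub_left,
      real_inner_smul_left, real_inner_smul_right, inner_zero_left, e4,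
      real_inner_self_eq_norm_sq (z t)]
    linear_combination e3
  · filter_upwards [hzM, eventually_ge_atTop 0] with t h1 h0
    refine ⟨hα.le_of_le hΔ (norm_nonneg _) ((norm_add_le _ _).trans (add_le_add h1 ?_)), ha1 t⟩
    rw [norm_smul, Real.norm_eq_abs, abs_of_pos (by positivity)]
    exact mul_le_of_le_one_right (by positivity) (hht1 t h0)
  · filter_upwards [eventually_ge_atTop 0] with t h0
    simpa [hh t h0, hhs t h0] using abs_real_inner_le_norm (h t) (hs t)
  · exact Eventually.of_forall fun t => sq_nonneg _
  · filter_upwards [eventually_ge_atTop 0] with t h0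
    rw [← hhtn t h0, ← mul_pow, ← sq_abs]
    gcongr
    exact abs_real_inner_le_norm _ _
  · refine hε.of_le 1 ?_
    filter_upwards [eventually_ge_atTop 0] with t h0
    simpa [hhs t h0] using abs_real_inner_le_norm (ε t) (hs t)
  · refine hε.of_le (√M) ?_
    filter_upwards [eventually_ge_atTop 0, hzM] with t h0 h1
    have h2 := norm_cross_le (ε t) (hs t)
    rw [hhs t h0, mul_one] at h2
    calc ‖⟪cross (ε t) (hs t), z t⟫‖ ≤ ‖cross (ε t) (hs t)‖ * ‖z t‖ := abs_real_inner_le_norm _ _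
      _ ≤ ‖ε t‖ * √M := by gcongr
      _ = _ := mul_comm _ _

/-! ### Guidance -/

theorem hasDerivAt_of_differentiableOn {E : Type*} [NormedAddCommGroup E] [NormedSpace ℝ E]
    {f : ℝ → E} (hf : DifferentiableOn ℝ f (Ici 0)) {t : ℝ} (ht : 0 < t) :
    HasDerivAt f (ddt f t) t :=
  (hf t ht.le).hasDerivWithinAt.hasDerivAt (Ici_mem_nhds ht)

section Guidance

variable {P : Path} {F : Flight} {s : ℝ → ℝ} {α : ℝ → ℝ → ℝ} {Q : GuidanceParams} {t : ℝ}

/-- First-order condition for a local minimum, applied to the squared distance, which is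
differentiable even where the distance vanishes. -/
theorem IsProjection.inner_ptilde_tangent (h : IsProjection P F s) (ht : 0 ≤ t) :
    ⟪ptilde P F s t, P.u (s t)⟫ = 0 := by
  have h1 : IsLocalMin (fun σ => ‖F.p t - P.q σ‖ ^ 2) (s t) := by
    filter_upwards [h.closest t ht] with σ hσ
    gcongr
  have h2 := ((P.deriv_q (s t)).const_sub (F.p t)).norm_sq
  have h3 := h1.hasDerivAt_eq_zero h2
  rw [inner_neg_right] at h3
  simp only [ptilde]
  linarith

theorem yerr_zero : yerr P F s t 0 = ⟪ptilde P F s t, P.u₁ (s t)⟫ := rfl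

theorem yerr_one : yerr P F s t 1 = ⟪ptilde P F s t, P.u₂ (s t)⟫ := rfl

theorem IsProjection.ptilde_eq (h : IsProjection P F s) (ht : 0 ≤ t) :
    ptilde P F s t = yerr P F s t 0 • P.u₁ (s t) + yerr P F s t 1 • P.u₂ (s t) := by
  have := (P.frame (s t)).eq_add_add (ptilde P F s t)
  rwa [h.inner_ptilde_tangent ht, zero_smul, zero_add] at this

theorem norm_sq_eq_fin_two (x : EuclideanSpace ℝ (Fin 2)) : ‖x‖ ^ 2 = x 0 ^ 2 + x 1 ^ 2 := by
  rw [EuclideanSpace.real_norm_sq_eq, Fin.sum_univ_two]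

theorem norm_sq_add_of_frame {a b c : E3} (h : IsDirectFrame a b c) (x y : ℝ) :
    ‖x • b + y • c‖ ^ 2 = x ^ 2 + y ^ 2 := by
  rw [← real_inner_self_eq_norm_sq]
  simp only [inner_add_left, inner_add_right, real_inner_smul_left, real_inner_smul_right,
    h.inner_snd_snd, h.inner_thd_thd, h.inner_thd_snd, h.inner_snd_thd]
  ring

theorem IsProjection.norm_yerr (h : IsProjection P F s) (ht : 0 ≤ t) :
    ‖yerr P F s t‖ = ‖ptilde P F s t‖ := by
  refine (sq_eq_sq₀ (norm_nonneg _) (norm_nonneg _)).1 ?_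
  rw [h.ptilde_eq ht, norm_sq_add_of_frame (P.frame (s t)), norm_sq_eq_fin_two]

theorem ybar_zero : ybar P F s t α Q 0 =
    Q.k₁ * α (levelH F t Q) ‖yerr P F s t‖ / ‖F.v t‖ * (Q.d₁ * yerr P F s t 0) := by
  simp only [ybar, sat, PiLp.smul_apply, smul_eq_mul]
  change Q.k₁ * Q.d₁ * _ / _ = _
  ring

theorem ybar_one : ybar P F s t α Q 1 =
    Q.k₁ * α (levelH F t Q) ‖yerr P F s t‖ / ‖F.v t‖ * (Q.d₂ * yerr P F s t 1) := by
  simp only [ybar, sat, PiLp.smul_apply, smul_eq_mul]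
  change Q.k₁ * Q.d₂ * _ / _ = _
  ring

theorem GuidanceParams.max_pos (Q : GuidanceParams) : 0 < max Q.d₁ Q.d₂ :=
  lt_max_of_lt_left Q.d₁_mem.1

theorem levelH_pos (hv : 0 < ‖F.v t‖) : 0 < levelH F t Q :=
  div_pos (mul_pos Q.μ_mem.1 hv) (mul_pos Q.k₁_pos Q.max_pos)

theorem norm_ybar_le (hα : IsSaturationFamily α) (hv : 0 < ‖F.v t‖) :
    ‖ybar P F s t α Q‖ ≤
      Q.k₁ * α (levelH F t Q) ‖yerr P F s t‖ / ‖F.v t‖ * (max Q.d₁ Q.d₂ * ‖yerr P F s t‖) := by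
  have ha := hα.pos _ (levelH_pos (Q := Q) hv) _ (norm_nonneg (yerr P F s t))
  have hk := Q.k₁_pos
  have hm := Q.max_pos
  refine abs_le_of_sq_le_sq' ?_ (by positivity) |>.2
  have hy := norm_sq_eq_fin_two (yerr P F s t)
  rw [norm_sq_eq_fin_two, ybar_zero, ybar_one, mul_pow, mul_pow, mul_pow, mul_pow Q.d₂,
    mul_pow, mul_pow (max _ _), hy, ← mul_add]
  have h1 : Q.d₁ ^ 2 ≤ max Q.d₁ Q.d₂ ^ 2 :=
    pow_le_pow_left₀ Q.d₁_mem.1.le (le_max_left _ _) 2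
  have h2 : Q.d₂ ^ 2 ≤ max Q.d₁ Q.d₂ ^ 2 :=
    pow_le_pow_left₀ Q.d₂_mem.1.le (le_max_right _ _) 2
  refine mul_le_mul_of_nonneg_left ?_ (sq_nonneg _)
  rw [mul_add]
  gcongr

theorem norm_ybar_le_mul_norm (hα : IsSaturationFamily α) (hv : 0 < ‖F.v t‖) :
    ‖ybar P F s t α Q‖ ≤ Q.k₁ * max Q.d₁ Q.d₂ / ‖F.v t‖ * ‖yerr P F s t‖ := by
  refine (norm_ybar_le hα hv).trans ?_
  have ha := hα.le_one (levelH_pos (Q := Q) hv) (norm_nonneg (yerr P F s t))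
  have hk := Q.k₁_pos
  have hm := Q.max_pos
  calc _ ≤ Q.k₁ * 1 / ‖F.v t‖ * (max Q.d₁ Q.d₂ * ‖yerr P F s t‖) := by gcongr
    _ = _ := by ring

/-- The level `levelH` is tuned so that `‖ȳ‖ ≤ μ`. -/
theorem norm_ybar_lt_one (hα : IsSaturationFamily α) (hv : 0 < ‖F.v t‖) :
    ‖ybar P F s t α Q‖ < 1 := by
  refine lt_of_le_of_lt ?_ Q.μ_mem.2
  refine (norm_ybar_le hα hv).trans ?_
  have ha := hα.mul_le (levelH_pos (Q := Q) hv) (norm_nonneg (yerr P F s t))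
  have hk := Q.k₁_pos
  have hm := Q.max_pos
  calc _ = Q.k₁ * max Q.d₁ Q.d₂ / ‖F.v t‖ *
        (α (levelH F t Q) ‖yerr P F s t‖ * ‖yerr P F s t‖) := by ring
    _ ≤ Q.k₁ * max Q.d₁ Q.d₂ / ‖F.v t‖ * levelH F t Q := by gcongr
    _ = Q.μ := by rw [levelH]; field_simp

/-- The angle is `arcsin ‖ȳ‖`, so its sine cancels the norm in the denominator of `lvec`; the
resulting expression is regular at `ȳ = 0`. -/
theorem guidanceHeading_eq (hα : IsSaturationFamily α) (hv : 0 < ‖F.v t‖) :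
    guidanceHeading P F s t α Q =
      -(ybar P F s t α Q 0 • P.u₁ (s t) + ybar P F s t α Q 1 • P.u₂ (s t)) +
        (√(1 - ‖ybar P F s t α Q‖ ^ 2) * Q.σ) • P.u (s t) := by
  have h1 := norm_ybar_lt_one (P := P) (s := s) (Q := Q) hα hv
  have h0 := norm_nonneg (ybar P F s t α Q)
  have hθ : thetaH P F s t α Q = Real.arcsin ‖ybar P F s t α Q‖ := by
    rw [Real.arcsin_eq_arctan ⟨by linarith, h1⟩, thetaH]
  rw [guidanceHeading, hθ, Real.sin_arcsin (by linarith) h1.le, Real.cos_arcsin, lvec, smul_neg,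
    smul_smul]
  congr 2
  rcases h0.eq_or_lt with h | h
  · have : ybar P F s t α Q = 0 := norm_eq_zero.1 h.symm
    simp [this]
  · rw [mul_one_div_cancel h.ne', one_smul]

theorem norm_guidanceHeading_sub_le (hα : IsSaturationFamily α) (hv : 0 < ‖F.v t‖) :
    ‖guidanceHeading P F s t α Q - Q.σ • P.u (s t)‖ ≤ 2 * ‖ybar P F s t α Q‖ := by
  have h1 := norm_ybar_lt_one (P := P) (s := s) (Q := Q) hα hv
  set r := ‖ybar P F s t α Q‖ with hr
  have h0 : 0 ≤ r := norm_nonneg _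
  have e : guidanceHeading P F s t α Q - Q.σ • P.u (s t) =
      -(ybar P F s t α Q 0 • P.u₁ (s t) + ybar P F s t α Q 1 • P.u₂ (s t)) +
        ((√(1 - r ^ 2) - 1) * Q.σ) • P.u (s t) := by
    rw [guidanceHeading_eq hα hv, ← hr, sub_mul, sub_smul, one_mul]
    abel
  have h2 : ‖ybar P F s t α Q 0 • P.u₁ (s t) + ybar P F s t α Q 1 • P.u₂ (s t)‖ = r := by
    refine (sq_eq_sq₀ (norm_nonneg _) h0).1 ?_
    rw [norm_sq_add_of_frame (P.frame (s t)), hr, norm_sq_eq_fin_two]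
  have h3 : |√(1 - r ^ 2) - 1| ≤ r := by
    have h4 : 1 - r ≤ √(1 - r ^ 2) := Real.le_sqrt_of_sq_le (by nlinarith)
    have h5 : √(1 - r ^ 2) ≤ 1 := Real.sqrt_le_one.2 (by nlinarith)
    rw [abs_le]
    constructor <;> linarith
  have hσ : |Q.σ| = 1 := by rcases Q.σ_eq with h | h <;> simp [h]
  rw [e]
  refine (norm_add_le _ _).trans ?_
  rw [norm_neg, h2, norm_smul, (P.frame (s t)).norm_fst, Real.norm_eq_abs, abs_mul, hσ]
  linarith

/-- The tangential part of the heading is invisible to the path error, and the normal part `-ȳ`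
points back to the path with gains at least `min d₁ d₂`. -/
theorem IsProjection.inner_ptilde_guidanceHeading (h : IsProjection P F s) (ht : 0 ≤ t)
    (hα : IsSaturationFamily α) (hv : 0 < ‖F.v t‖) :
    ⟪ptilde P F s t, guidanceHeading P F s t α Q⟫ ≤
      -(Q.k₁ * min Q.d₁ Q.d₂ * α (levelH F t Q) ‖ptilde P F s t‖ / ‖F.v t‖
        * ‖ptilde P F s t‖ ^ 2) := by
  have ha := hα.pos _ (levelH_pos (Q := Q) hv) _ (norm_nonneg (yerr P F s t))
  have hk := Q.k₁_pos
  rw [guidanceHeading_eq hα hv, inner_add_right, inner_neg_right, inner_add_right,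
    real_inner_smul_right, real_inner_smul_right, real_inner_smul_right,
    h.inner_ptilde_tangent ht, ybar_zero, ybar_one, ← yerr_zero, ← yerr_one, ← h.norm_yerr ht]
  have hy := norm_sq_eq_fin_two (yerr P F s t)
  have h1 : min Q.d₁ Q.d₂ * yerr P F s t 0 ^ 2 ≤ Q.d₁ * yerr P F s t 0 ^ 2 := by
    gcongr; exact min_le_left _ _
  have h2 : min Q.d₁ Q.d₂ * yerr P F s t 1 ^ 2 ≤ Q.d₂ * yerr P F s t 1 ^ 2 := by
    gcongr; exact min_le_right _ _
  have h3 : 0 ≤ Q.k₁ * α (levelH F t Q) ‖yerr P F s t‖ / ‖F.v t‖ := by positivity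
  have h4 := mul_le_mul_of_nonneg_left (add_le_add h1 h2) h3
  linear_combination h4 +
    Q.k₁ * α (levelH F t Q) ‖yerr P F s t‖ / ‖F.v t‖ * min Q.d₁ Q.d₂ * hy

/-- With the guidance law, the path error decays exponentially when the heading error does. -/
theorem IsProjection.path_following (hproj : IsProjection P F s) (hα : IsSaturationFamily α)
    (hp : ∀ t > 0, HasDerivAt F.p (F.v t) t) {δ B : ℝ} (hδ : 0 < δ)
    (hv : ∀ t ≥ 0, δ ≤ ‖F.v t‖) (hB : ∀ᶠ t in atTop, ‖F.v t‖ ≤ B)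
    (hh : TendsToZeroUltExp (fun t => F.h t - guidanceHeading P F s t α Q)) :
    TendsToZeroUltExp (fun t => ptilde P F s t) ∧
      TendsToZeroUltExp (fun t => F.h t - Q.σ • P.u (s t)) := by
  have hv0 : ∀ t ≥ 0, 0 < ‖F.v t‖ := fun t ht => hδ.trans_le (hv t ht)
  have hB0 : 0 < B := by
    obtain ⟨t, h1, h2⟩ := (hB.and (eventually_ge_atTop 0)).exists
    exact (hv0 t h2).trans_le h1
  set e : ℝ → ℝ := fun t => ‖F.h t - guidanceHeading P F s t α Q‖ with he
  set f : ℝ → ℝ := fun t => ‖ptilde P F s t‖ ^ 2 with hf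
  set a : ℝ → ℝ := fun t => α (levelH F t Q) ‖ptilde P F s t‖ with ha
  have ha0 : ∀ t ≥ 0, 0 < a t := fun t ht => hα.pos _ (levelH_pos (hv0 t ht)) _ (norm_nonneg _)
  have hd0 : 0 < min Q.d₁ Q.d₂ := lt_min Q.d₁_mem.1 Q.d₂_mem.1
  have hk := Q.k₁_pos
  have hm := Q.max_pos
  -- The motion of the projection point contributes along the tangent only, hence nothing.
  have hfd : ∀ t > 0, HasDerivAt f (2 * ⟪ptilde P F s t, F.v t⟫) t := by
    intro t ht
    have h1 := hasDerivAt_of_differentiableOn hproj.differentiable ht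
    have h2 : HasDerivAt (ptilde P F s) (F.v t - ddt s t • P.u (s t)) t :=
      (hp t ht).sub ((P.deriv_q (s t)).scomp t h1)
    refine h2.norm_sq.congr_deriv ?_
    rw [inner_sub_right, real_inner_smul_right, hproj.inner_ptilde_tangent ht.le, mul_zero, sub_zero]
  have hfle : ∀ᶠ t in atTop, 2 * ⟪ptilde P F s t, F.v t⟫ ≤
      -(2 * (Q.k₁ * min Q.d₁ Q.d₂) * a t * f t) + 2 * B * (‖ptilde P F s t‖ * e t) := by
    filter_upwards [hB, eventually_ge_atTop 0] with t h1 ht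
    have hvt := hv0 t ht
    have h2 : F.v t = ‖F.v t‖ • F.h t := by
      rw [Flight.h, smul_smul, mul_one_div_cancel hvt.ne', one_smul]
    have h3 : ⟪ptilde P F s t, F.h t⟫ ≤ ⟪ptilde P F s t, guidanceHeading P F s t α Q⟫ +
        ‖ptilde P F s t‖ * e t := by
      have := real_inner_le_norm (ptilde P F s t) (F.h t - guidanceHeading P F s t α Q)
      rw [inner_sub_right] at this
      linarith
    have h4 := h3.trans (add_le_add_left (hproj.inner_ptilde_guidanceHeading (Q := Q) ht hα hvt) _)
    have h5 := mul_le_mul_of_nonneg_left h4 hvt.le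
    have h6 : ‖F.v t‖ * (-(Q.k₁ * min Q.d₁ Q.d₂ * α (levelH F t Q) ‖ptilde P F s t‖ / ‖F.v t‖
        * ‖ptilde P F s t‖ ^ 2)) = -(Q.k₁ * min Q.d₁ Q.d₂ * a t * f t) := by
      simp only [ha, hf]
      field_simp
    have h7 : ‖F.v t‖ * (‖ptilde P F s t‖ * e t) ≤ B * (‖ptilde P F s t‖ * e t) := by gcongr
    have h8 : ⟪ptilde P F s t, F.v t⟫ = ‖F.v t‖ * ⟪ptilde P F s t, F.h t⟫ := by
      conv_lhs => rw [h2]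
      rw [real_inner_smul_right]
    rw [h8]
    rw [mul_add, h6] at h5
    linarith
  have hf0 : ∀ t, 0 ≤ f t := fun t => sq_nonneg _
  -- The perturbation `2 B ‖p̃‖ e` is at most `B e (1 + f)`, so `log (1 + f)` grows at most at the
  -- integrable rate `B e`. Boundedness has to come first, because the damping `a` degenerates for
  -- large path errors.
  obtain ⟨R, hR0, hR⟩ : ∃ R, 0 ≤ R ∧ ∀ᶠ t in atTop, ‖ptilde P F s t‖ ≤ R := by
    have hlog : ∀ᶠ t in atTop, HasDerivAt (fun t => Real.log (1 + f t))
        (2 * ⟪ptilde P F s t, F.v t⟫ / (1 + f t)) t := by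
      filter_upwards [eventually_gt_atTop 0] with t ht
      exact ((hfd t ht).const_add 1).log (by linarith [hf0 t])
    obtain ⟨ζ, ζ', -, hζ0, hζd⟩ := exists_antitone_correction (f := fun _ => 0)
      (g := fun t => B * e t) hlog (hh.of_le B (by
        filter_upwards with t
        rw [norm_mul, Real.norm_eq_abs, abs_of_pos hB0, he, norm_norm])) (by
        filter_upwards [hfle, eventually_ge_atTop 0] with t h1 ht
        rw [div_le_iff₀ (by linarith [hf0 t])]
        have h2 : 0 ≤ 2 * (Q.k₁ * min Q.d₁ Q.d₂) * a t * f t :=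
          mul_nonneg (mul_nonneg (by positivity) (ha0 t ht).le) (hf0 t)
        have h3 : 2 * ‖ptilde P F s t‖ ≤ 1 + f t := by
          simp only [hf]
          nlinarith [sq_nonneg (1 - ‖ptilde P F s t‖)]
        have h4 := mul_le_mul_of_nonneg_left h3 (mul_nonneg hB0.le (norm_nonneg _) : 0 ≤ B * e t)
        linarith)
    obtain ⟨T, hT⟩ := eventually_atTop.1 (hζ0.and hζd)
    have hanti := antitoneOn_Ici_of_hasDerivAt (fun t ht => (hT t ht).2.1)
      (fun t ht => by simpa using (hT t ht).2.2)
    refine ⟨1 + Real.exp (Real.log (1 + f T) + ζ T), by positivity, ?_⟩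
    filter_upwards [eventually_ge_atTop T] with t ht
    have h1 := hanti (mem_Ici.2 le_rfl) (mem_Ici.2 ht) ht
    have h2 := (hT t ht).1
    have h3 : 1 + f t ≤ Real.exp (Real.log (1 + f T) + ζ T) := by
      rw [← Real.log_le_iff_le_exp (by linarith [hf0 t])]
      simp only at h1
      linarith
    simp only [hf] at h3 ⊢
    nlinarith [sq_nonneg (‖ptilde P F s t‖ - 1)]
  -- The saturation level varies with the speed. The level and the error both stay in a compact set,
  -- on which the jointly continuous `α` has a positive minimum.
  obtain ⟨κ, hκ, hκa⟩ : ∃ κ > 0, ∀ᶠ t in atTop, κ ≤ a t := by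
    set l₁ := Q.μ * δ / (Q.k₁ * max Q.d₁ Q.d₂) with hl₁
    set l₂ := Q.μ * B / (Q.k₁ * max Q.d₁ Q.d₂) with hl₂
    have hμ := Q.μ_mem.1
    have hl₁0 : 0 < l₁ := by positivity
    have hsub : Icc l₁ l₂ ×ˢ Icc 0 R ⊆ Ioi (0 : ℝ) ×ˢ Ici (0 : ℝ) :=
      prod_mono (fun x hx => hl₁0.trans_le hx.1) (fun x hx => hx.1)
    have hmem : ∀ᶠ t in atTop, (levelH F t Q, ‖ptilde P F s t‖) ∈ Icc l₁ l₂ ×ˢ Icc 0 R := by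
      filter_upwards [hB, hR, eventually_ge_atTop 0] with t h1 h2 ht
      refine ⟨⟨?_, ?_⟩, norm_nonneg _, h2⟩
      · simp only [levelH, hl₁]
        gcongr
        exact hv t ht
      · simp only [levelH, hl₂]
        gcongr
    obtain ⟨t₀, ht₀⟩ := hmem.exists
    obtain ⟨q, hq, hmin⟩ := (isCompact_Icc.prod isCompact_Icc).exists_isMinOn ⟨_, ht₀⟩
      (hα.continuous_joint.mono hsub)
    refine ⟨α q.1 q.2, hα.pos _ (hsub hq).1 _ (hsub hq).2, ?_⟩
    filter_upwards [hmem] with t ht using hmin ht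
  have hfexp : TendsToZeroUltExp f := by
    refine TendsToZeroUltExp.of_deriv_le (c := 2 * (Q.k₁ * min Q.d₁ Q.d₂) * κ)
      (g := fun t => 2 * B * (R * e t)) (by positivity)
      (by filter_upwards [eventually_gt_atTop 0] with t ht using hfd t ht)
      (Eventually.of_forall hf0) (hh.of_le (2 * B * R) ?_) ?_
    · filter_upwards with t
      rw [← mul_assoc, norm_mul, Real.norm_eq_abs, abs_of_nonneg (by positivity), he, norm_norm]
    · filter_upwards [hfle, hκa, hR] with t h1 h2 h3
      refine h1.trans (add_le_add ?_ ?_)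
      · rw [neg_mul]
        refine neg_le_neg (mul_le_mul_of_nonneg_right ?_ (hf0 t))
        gcongr
      · have : 0 ≤ e t := norm_nonneg _
        gcongr
  have hpexp : TendsToZeroUltExp (fun t => ptilde P F s t) := by
    refine hfexp.of_sq_le 1 (Eventually.of_forall fun t => ?_)
    rw [one_mul]
    exact Real.le_norm_self _
  refine ⟨hpexp, ?_⟩
  have h1 : TendsToZeroUltExp (fun t => guidanceHeading P F s t α Q - Q.σ • P.u (s t)) := by
    refine hpexp.of_le (2 * (Q.k₁ * max Q.d₁ Q.d₂ / δ)) ?_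
    filter_upwards [eventually_ge_atTop 0] with t ht
    have h2 := norm_guidanceHeading_sub_le (P := P) (s := s) (Q := Q) hα (hv0 t ht)
    have h3 := norm_ybar_le_mul_norm (P := P) (s := s) (Q := Q) hα (hv0 t ht)
    rw [hproj.norm_yerr ht] at h3
    have h4 : Q.k₁ * max Q.d₁ Q.d₂ / ‖F.v t‖ * ‖ptilde P F s t‖ ≤
        Q.k₁ * max Q.d₁ Q.d₂ / δ * ‖ptilde P F s t‖ := by
      gcongr
      exact hv t ht
    linarith
  exact (hh.add h1).congr' (Eventually.of_forall fun t => by abel)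

end Guidance

/-! ### Derivatives of unit vectors and norms -/

theorem inner_deriv_eq_zero_of_eq {a b : ℝ → E3} {a' b' : E3} {C t : ℝ} (ht : 0 < t)
    (ha : HasDerivAt a a' t) (hb : HasDerivAt b b' t) (h : ∀ s ≥ 0, ⟪a s, b s⟫ = C) :
    ⟪a t, b'⟫ + ⟪a', b t⟫ = 0 := by
  refine (ha.inner ℝ hb).unique ((hasDerivAt_const t C).congr_of_eventuallyEq ?_)
  filter_upwards [lt_mem_nhds ht] with s hs using h s hs.le

theorem inner_deriv_eq_zero_of_unit {a : ℝ → E3} {a' : E3} {t : ℝ} (ht : 0 < t)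
    (ha : HasDerivAt a a' t) (h : ∀ s ≥ 0, ‖a s‖ = 1) : ⟪a t, a'⟫ = 0 := by
  have := inner_deriv_eq_zero_of_eq (C := 1) ht ha ha fun s hs => by
    rw [real_inner_self_eq_norm_sq, h s hs, one_pow]
  rw [real_inner_comm (a t) a'] at this
  linarith

theorem hasDerivAt_norm {f : ℝ → E3} {f' : E3} {t : ℝ} (hf : HasDerivAt f f' t) (h : f t ≠ 0) :
    HasDerivAt (fun t => ‖f t‖) (⟪(1 / ‖f t‖) • f t, f'⟫) t := by
  have h1 := hf.norm_sq.sqrt (pow_ne_zero 2 (norm_ne_zero_iff.2 h))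
  simp only [Real.sqrt_sq (norm_nonneg _)] at h1
  refine h1.congr_deriv ?_
  rw [real_inner_smul_left]
  have := norm_ne_zero_iff.2 h
  field_simp

theorem hasDerivAt_normalize {f : ℝ → E3} {f' : E3} {t : ℝ} (hf : HasDerivAt f f' t)
    (h : f t ≠ 0) : HasDerivAt (fun t => (1 / ‖f t‖) • f t)
      ((1 / ‖f t‖) • (f' - ⟪(1 / ‖f t‖) • f t, f'⟫ • ((1 / ‖f t‖) • f t))) t := by
  have h0 := norm_ne_zero_iff.2 h
  have h1 := ((hasDerivAt_norm hf h).fun_inv h0).smul hf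
  simp only [one_div]
  refine h1.congr_deriv ?_
  match_scalars <;> field_simp

theorem continuous_cross : Continuous (fun q : E3 × E3 => cross q.1 q.2) := by
  refine (PiLp.continuous_toLp 2 _).comp (continuous_pi fun n => ?_)
  fin_cases n <;> simp [crossProduct] <;> fun_prop

theorem continuousOn_cross {a b : ℝ → E3} {S : Set ℝ} (ha : ContinuousOn a S)
    (hb : ContinuousOn b S) : ContinuousOn (fun t => cross (a t) (b t)) S :=
  continuous_cross.comp_continuousOn (ha.prodMk hb)

theorem continuousOn_inner_add_inner_add_inner {a b c a' b' c' : ℝ → E3} {S : Set ℝ}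
    (ha : ContinuousOn a S) (hb : ContinuousOn b S) (hc : ContinuousOn c S)
    (ha' : ContinuousOn a' S) (hb' : ContinuousOn b' S) (hc' : ContinuousOn c' S) :
    ContinuousOn (fun t => ⟪a t, a' t⟫ + ⟪b t, b' t⟫ + ⟪c t, c' t⟫) S := by
  fun_prop

/-! ### The desired frame -/

section ClosedLoop

variable {A : Aircraft} {α : ℝ → ℝ → ℝ} {G : Gains} {vs : ℝ → ℝ} {hs : ℝ → E3} {F : Flight}
  {t δ : ℝ}

theorem norm_normalize {x : E3} (h : 0 < ‖x‖) : ‖(1 / ‖x‖) • x‖ = 1 := by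
  rw [norm_smul, norm_div, norm_one, norm_norm, one_div_mul_cancel h.ne']

theorem isDirectFrame_desired (h₁ : 0 < ‖astar α G vs hs F t - A.gbar F t‖)
    (h₂ : 0 < ‖cross (ibar A α G vs hs F t) (A.va F t)‖) :
    IsDirectFrame (ibar A α G vs hs F t) (jbar A α G vs hs F t) (kbar A α G vs hs F t) where
  norm_fst := norm_normalize h₁
  norm_snd := norm_normalize (by rwa [cross_swap, norm_neg])
  orthogonal := by
    rw [jbar, real_inner_smul_right, real_inner_comm, inner_cross_self_right, mul_zero]
  thd_eq := rfl

theorem inner_va_jbar : ⟪A.va F t, jbar A α G vs hs F t⟫ = 0 := by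
  rw [jbar, real_inner_smul_right, real_inner_comm, inner_cross_self_left, mul_zero]

variable (hF : IsClosedLoop A α G vs hs F)
include hF

/-- The term `ī × ī'` reproduces `ī'` because `ī'` is orthogonal to `ī`. For `j̄'`, the component
along `ī` is then forced by `ī · j̄ = 0`, and the added spin about `ī` supplies the component along
`k̄`. The Jacobi identity gives the third vector. -/
theorem IsClosedLoop.hasDerivAt_desired
    (hfr : ∀ t ≥ 0, IsDirectFrame (ibar A α G vs hs F t) (jbar A α G vs hs F t)
      (kbar A α G vs hs F t)) (ht : 0 < t) :
    HasDerivAt (ibar A α G vs hs F)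
      (cross (omegaBar A α G vs hs F t) (ibar A α G vs hs F t)) t ∧
    HasDerivAt (jbar A α G vs hs F)
      (cross (omegaBar A α G vs hs F t) (jbar A α G vs hs F t)) t ∧
    HasDerivAt (kbar A α G vs hs F)
      (cross (omegaBar A α G vs hs F t) (kbar A α G vs hs F t)) t := by
  have hi := hasDerivAt_of_differentiableOn hF.ibar_differentiable ht
  have hj := hasDerivAt_of_differentiableOn hF.jbar_differentiable ht
  have f := hfr t ht.le
  have e1 := inner_deriv_eq_zero_of_unit ht hi fun s hs => (hfr s hs).norm_fst
  have e2 := inner_deriv_eq_zero_of_unit ht hj fun s hs => (hfr s hs).norm_snd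
  have e3 := inner_deriv_eq_zero_of_eq ht hi hj fun s hs => (hfr s hs).orthogonal
  have hi' : cross (omegaBar A α G vs hs F t) (ibar A α G vs hs F t) =
      ddt (ibar A α G vs hs F) t := by
    rw [omegaBar, omegaIbar, cross_add_left, cross_cross, cross_smul_left, f.inner_fst_fst,
      real_inner_comm, e1]
    have : cross (ibar A α G vs hs F t) (ibar A α G vs hs F t) = 0 := by
      apply E3_ext <;> simp [cross_apply_zero, cross_apply_one, cross_apply_two, mul_comm]
    simp [this]
  have hj' : cross (omegaBar A α G vs hs F t) (jbar A α G vs hs F t) =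
      ddt (jbar A α G vs hs F) t := by
    have h1 := f.eq_add_add (ddt (jbar A α G vs hs F) t)
    rw [real_inner_comm, real_inner_comm (jbar A α G vs hs F t), e2] at h1
    rw [omegaBar, omegaIbar, cross_add_left, cross_cross, cross_smul_left, f.orthogonal,
      omegaJbar, ← inner_cross_left, ← f.thd_eq]
    conv_rhs => rw [h1]
    rw [real_inner_comm (kbar A α G vs hs F t), show ⟪ibar A α G vs hs F t,
      ddt (jbar A α G vs hs F) t⟫ = -⟪ddt (ibar A α G vs hs F) t, jbar A α G vs hs F t⟫ by linarith]
    module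
  refine ⟨hi'.symm ▸ hi, hj'.symm ▸ hj, ?_⟩
  have hk := hasDerivAt_cross (hi'.symm ▸ hi) (hj'.symm ▸ hj)
  rw [cross_jacobi] at hk
  exact hk

/-- The body frame converges to the desired frame. -/
theorem IsClosedLoop.attitude_tracking
    (hfr : ∀ t ≥ 0, IsDirectFrame (ibar A α G vs hs F t) (jbar A α G vs hs F t)
      (kbar A α G vs hs F t)) (h_angle : frameAngle A α G vs hs F 0 ≠ Real.pi) :
    TendsToZeroUltExp (fun t => F.i t - ibar A α G vs hs F t) ∧
    TendsToZeroUltExp (fun t => F.j t - jbar A α G vs hs F t) ∧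
    TendsToZeroUltExp (fun t => F.k t - kbar A α G vs hs F t) := by
  obtain ⟨ε, hε, hκ⟩ := G.kω_pos
  refine frame_tracking (i' := ibar A α G vs hs F) (j' := jbar A α G vs hs F)
    (k' := kbar A α G vs hs F) (Ω := omega A α G vs hs F) (Ω' := omegaBar A α G vs hs F) hε
    hF.body_frame hfr
    (fun t ht => (hF.attitude_i t ht.le).hasDerivAt (Ici_mem_nhds ht))
    (fun t ht => (hF.attitude_j t ht.le).hasDerivAt (Ici_mem_nhds ht))
    (fun t ht => (hF.attitude_k t ht.le).hasDerivAt (Ici_mem_nhds ht))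
    (fun t ht => (hF.hasDerivAt_desired hfr ht).1) (fun t ht => (hF.hasDerivAt_desired hfr ht).2.1)
    (fun t ht => (hF.hasDerivAt_desired hfr ht).2.2) (κ := G.kω) (fun t _ => rfl) hκ ?_ ?_
  · have ci := hF.ibar_differentiable.continuousOn
    have cj := hF.jbar_differentiable.continuousOn
    have ck : ContinuousOn (kbar A α G vs hs F) (Ici 0) :=
      continuousOn_cross (a := ibar A α G vs hs F) (b := jbar A α G vs hs F) ci cj
    have ci' : ContinuousOn F.i (Ici 0) := fun t ht => (hF.attitude_i t ht).continuousWithinAt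
    have cj' : ContinuousOn F.j (Ici 0) := fun t ht => (hF.attitude_j t ht).continuousWithinAt
    have ck' : ContinuousOn F.k (Ici 0) := fun t ht => (hF.attitude_k t ht).continuousWithinAt
    exact continuousOn_inner_add_inner_add_inner (a' := ibar A α G vs hs F)
      (b' := jbar A α G vs hs F) (c' := kbar A α G vs hs F) ci' cj' ck' ci cj ck
  -- The angle differs from `π` exactly when the trace exceeds `-1`.
  · rw [frameAngle, Ne, Real.arccos_eq_pi, not_le] at h_angle
    linarith

/-! ### Equations of motion under the thrust control -/

/-- The part of the acceleration that is due to the lateral air-speed. -/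
noncomputable def lateralAccel (A : Aircraft) (F : Flight) (t : ℝ) : E3 :=
  (A.va2 F t / A.m) •
    (A.O (F.i t) (F.j t) (F.k t) (A.va F t) + (A.cbar * ‖A.va F t‖) • F.j t)

/-- The thrust correction `2 c₁ v_{a,1} |v_a|` raises the drag coefficient along `i` from `c₀` to
`c̄₀`. Adding and subtracting the same drag along `j` makes it isotropic, which is the drag in `ḡ`;
the remainder is proportional to `v_{a,2}`. -/
theorem IsClosedLoop.acceleration_eq (ht : 0 ≤ t) :
    F.a t = A.gbar F t + (Tbar A α G vs F t / A.m) • F.i t + lateralAccel A F t := by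
  have hv : A.va F t = A.va1 F t • F.i t + A.va2 F t • F.j t + A.va3 F t • F.k t :=
    (hF.body_frame t ht).eq_add_add (A.va F t)
  have hg : A.gbar F t = A.g - (A.cbar / A.m * ‖A.va F t‖) •
      (A.va1 F t • F.i t + A.va2 F t • F.j t + A.va3 F t • F.k t) := by
    rw [Aircraft.gbar, ← hv]
  have hm := A.m_pos.ne'
  have h1 : F.a t = (1 / A.m) • (A.m • F.a t) := by
    rw [smul_smul, one_div_mul_cancel hm, one_smul]
  rw [h1, hF.newton t ht, hg, Aircraft.Fa, thrust, lateralAccel, Aircraft.cbar]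
  match_scalars <;> field_simp <;> ring

theorem IsClosedLoop.hasDerivAt_v (ht : 0 < t) : HasDerivAt F.v (F.a t) t :=
  hasDerivAt_of_differentiableOn hF.velocity_differentiable ht

theorem IsClosedLoop.inner_heading_acceleration (ht : 0 ≤ t) (hih : ⟪F.i t, F.h t⟫ ≠ 0) :
    ⟪F.h t, F.a t⟫ = ddt vs t - G.kT1 (F.ev vs t) * F.ev vs t
      - G.kT2 (F.ev vs t) * α G.ΔI |F.I t + F.ev vs t / G.kT3| * F.I t
      + ⟪F.h t, lateralAccel A F t⟫ := by
  have hm := A.m_pos.ne'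
  rw [hF.acceleration_eq ht, inner_add_right, inner_add_right, real_inner_smul_right, Tbar,
    real_inner_comm (F.i t) (F.h t), real_inner_comm (F.h t) (A.gbar F t)]
  field_simp
  ring

theorem IsClosedLoop.hasDerivAt_speedError (hvs : IsDesiredSpeed vs) (ht : 0 < t)
    (hv : F.v t ≠ 0) (hih : ⟪F.i t, F.h t⟫ ≠ 0) :
    HasDerivAt (F.ev vs) (-G.kT1 (F.ev vs t) * F.ev vs t
      - G.kT2 (F.ev vs t) * α G.ΔI |F.I t + F.ev vs t / G.kT3| * F.I t
      + ⟪F.h t, lateralAccel A F t⟫) t := by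
  have h1 : HasDerivAt (F.ev vs) (⟪F.h t, F.a t⟫ - ddt vs t) t :=
    (hasDerivAt_norm (hF.hasDerivAt_v ht) hv).sub
      (hasDerivAt_of_differentiableOn hvs.differentiable ht)
  refine h1.congr_deriv ?_
  rw [hF.inner_heading_acceleration ht.le hih]
  ring

/-- The leakage `-I` dominates the saturated term once `|I| ≥ ΔI`, whatever the speed error, so this
bound is available before any bound on the speed. -/
theorem IsClosedLoop.speedIntegrator_bounded (hα : IsSaturationFamily α) :
    ∃ M, 0 ≤ M ∧ ∀ᶠ t in atTop, |F.I t| ≤ M := by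
  obtain ⟨M, hM⟩ := eventually_le_of_deriv_nonpos_above (f := fun t => F.I t ^ 2)
    (f' := fun t => 2 * F.I t * Irate α G vs F t) (G.ΔI ^ 2) (by
      filter_upwards [eventually_gt_atTop 0] with t ht
      refine (((hF.speed_integrator t ht.le).hasDerivAt (Ici_mem_nhds ht)).pow 2).congr_deriv ?_
      simp) (by
      filter_upwards with t hB
      have h1 : G.ΔI ≤ |F.I t| := (le_abs_self _).trans (sq_le_sq.1 hB)
      have h2 := hα.norm_sat_le G.ΔI_pos (F.I t + F.ev vs t / G.kT3)
      rw [Real.norm_eq_abs] at h2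
      have h3 : F.I t * (-F.I t + sat α G.ΔI (F.I t + F.ev vs t / G.kT3)) ≤ 0 := by
        have h4 : F.I t * sat α G.ΔI (F.I t + F.ev vs t / G.kT3) ≤ |F.I t| * |F.I t| := by
          refine (le_abs_self _).trans ?_
          rw [abs_mul]
          exact mul_le_mul_of_nonneg_left (h2.trans h1) (abs_nonneg _)
        rw [abs_mul_abs_self] at h4
        linarith
      have h5 : 0 ≤ G.kT2 (F.ev vs t) * G.kT3 :=
        mul_nonneg (G.kT2_pos _).le G.kT3_pos.le
      have h6 := mul_nonpos_of_nonneg_of_nonpos h5 h3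
      rw [Irate]
      linarith)
  refine ⟨√M, Real.sqrt_nonneg _, ?_⟩
  filter_upwards [hM] with t ht
  exact Real.abs_le_sqrt ht

end ClosedLoop

/-- The superlinear proportional gain dominates perturbations that grow quadratically. -/
theorem speedError_bounded (G : Gains) {e b d : ℝ → ℝ} {M C K : ℝ} (hC : 0 ≤ C)
    (hK : 0 ≤ K)
    (he : ∀ᶠ t in atTop, HasDerivAt e (-G.kT1 (e t) * e t - G.kT2 (e t) * b t + d t) t)
    (hb : ∀ᶠ t in atTop, |b t| ≤ M) (hd : ∀ᶠ t in atTop, |d t| ≤ C * (|e t| + K) ^ 2) :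
    ∃ R, 0 ≤ R ∧ ∀ᶠ t in atTop, |e t| ≤ R := by
  obtain ⟨r₁, r₂, hr₁, hr⟩ := G.kT2_ratio
  have hk12 := G.kT12_pos
  have hlarge : ∀ᶠ x : ℝ in atTop, 8 * C / G.kT12 ≤ x ^ (G.pT - 1) :=
    (tendsto_rpow_atTop (by linarith [G.one_lt_pT])).eventually_ge_atTop _
  -- For `x = |e|` beyond `R`, the thresholds give `k_{T,1} ≥ 8 C x`, `k_{T,2} M ≤ k_{T,1} x / 2`
  -- and `(x + K)² ≤ 4 x²`. The integral term and the perturbation then each cost at most half of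
  -- the damping `k_{T,1} x²`.
  obtain ⟨R, hR⟩ := eventually_atTop.1 (hlarge.and ((eventually_ge_atTop (2 * M / r₁)).and
    ((eventually_ge_atTop K).and (eventually_gt_atTop 0))))
  have hR0 : 0 < R := (hR R le_rfl).2.2.2
  obtain ⟨B, hB⟩ := eventually_le_of_deriv_nonpos_above (f := fun t => e t ^ 2) (R ^ 2)
    (f' := fun t => 2 * e t * (-G.kT1 (e t) * e t - G.kT2 (e t) * b t + d t)) (by
      filter_upwards [he] with t ht
      refine (ht.pow 2).congr_deriv ?_
      simp) (by
      filter_upwards [hb, hd] with t hb hd hRt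
      have hRx : R ≤ |e t| := (le_abs_self R).trans (sq_le_sq.1 hRt)
      obtain ⟨h1, h2, h3, h4⟩ := hR _ hRx
      set x := |e t| with hx
      have hk1 : 8 * C * x ≤ G.kT1 (e t) := by
        have h5 : x ^ G.pT = x ^ (G.pT - 1) * x := by
          rw [← Real.rpow_add_one h4.ne', sub_add_cancel]
        have h6 := mul_le_mul_of_nonneg_right ((div_le_iff₀ hk12).1 h1) h4.le
        rw [Gains.kT1, ← hx, h5]
        linarith [G.kT11_pos]
      have hk1' : 0 ≤ G.kT1 (e t) := (by positivity : 0 ≤ 8 * C * x).trans hk1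
      have hk2 : G.kT2 (e t) * M ≤ G.kT1 (e t) * x / 2 := by
        have h5 : r₁ * G.kT2 (e t) ≤ G.kT1 (e t) := (le_div_iff₀ (G.kT2_pos _)).1 (hr (e t)).1
        have h6 : 2 * M ≤ x * r₁ := (div_le_iff₀ hr₁).1 h2
        have h7 := mul_le_mul_of_nonneg_left h6 (G.kT2_pos (e t)).le
        have h8 := mul_le_mul_of_nonneg_right h5 h4.le
        linarith
      have b1 : -(e t * (G.kT2 (e t) * b t)) ≤ x * (G.kT2 (e t) * M) := by
        refine (neg_le_abs _).trans ?_
        rw [abs_mul, abs_mul, abs_of_pos (G.kT2_pos _)]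
        have := (G.kT2_pos (e t)).le
        gcongr
      have b2 : e t * d t ≤ x * (4 * C * x ^ 2) := by
        refine (le_abs_self _).trans ?_
        rw [abs_mul]
        gcongr
        refine hd.trans ?_
        have : (x + K) ^ 2 ≤ (x + x) ^ 2 := by gcongr
        have := mul_le_mul_of_nonneg_left this hC
        linarith
      have b3 : e t * e t = x * x := (abs_mul_abs_self _).symm
      have b4 := mul_le_mul_of_nonneg_left hk2 h4.le
      have b5 := mul_le_mul_of_nonneg_right hk1 (mul_nonneg h4.le h4.le)
      linear_combination 2 * b1 + 2 * b2 + 2 * b4 + b5 - 2 * G.kT1 (e t) * b3)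
  refine ⟨√B, Real.sqrt_nonneg _, ?_⟩
  filter_upwards [hB] with t ht
  exact Real.abs_le_sqrt ht

theorem abs_arctan_le (x : ℝ) : |Real.arctan x| ≤ |x| := by
  have key : ∀ y ≥ 0, |Real.arctan y| ≤ |y| := fun y hy => by
    rw [abs_of_nonneg (Real.arctan_nonneg.2 hy), abs_of_nonneg hy]
    simpa using Real.le_tan (Real.arctan_nonneg.2 hy) (Real.arctan_lt_pi_div_two y)
  rcases le_total 0 x with h | h
  · exact key x h
  · simpa [Real.arctan_neg] using key (-x) (by linarith)

/-! ### Convergence of speed, acceleration and heading in the closed loop. -/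

section ClosedLoop

variable {A : Aircraft} {α : ℝ → ℝ → ℝ} {G : Gains} {vs : ℝ → ℝ} {hs : ℝ → E3} {F : Flight}
  {t δ : ℝ}

theorem Flight.norm_h (h : 0 < ‖F.v t‖) : ‖F.h t‖ = 1 := norm_normalize h

theorem Aircraft.cbar_pos (A : Aircraft) : 0 < A.cbar := by
  have := A.c₀_pos
  have := A.c₁_pos
  rw [Aircraft.cbar]
  positivity

theorem IsClosedLoop.norm_lateralAccel_le (hF : IsClosedLoop A α G vs hs F) :
    ∃ C, 0 ≤ C ∧ ∀ t ≥ 0, A.va F t ≠ 0 →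
      ‖lateralAccel A F t‖ ≤ C * (‖A.va F t‖ * |A.va2 F t|) := by
  obtain ⟨C, hC⟩ := A.O_bound
  have hm := A.m_pos
  have hc := A.cbar_pos
  refine ⟨(|C| + A.cbar) / A.m, by positivity, fun t ht hva => ?_⟩
  have hn : 0 < ‖A.va F t‖ := norm_pos_iff.2 hva
  have h1 := (div_le_iff₀ hn).1 (hC _ _ _ _ (hF.body_frame t ht) hva)
  have h2 : ‖A.O (F.i t) (F.j t) (F.k t) (A.va F t) + (A.cbar * ‖A.va F t‖) • F.j t‖ ≤
      (|C| + A.cbar) * ‖A.va F t‖ := by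
    refine (norm_add_le _ _).trans ?_
    rw [norm_smul, (hF.body_frame t ht).norm_snd, Real.norm_eq_abs, abs_of_pos (by positivity),
      mul_one, add_mul]
    gcongr
    exact h1.trans (by gcongr; exact le_abs_self C)
  rw [lateralAccel, norm_smul, Real.norm_eq_abs, abs_div, abs_of_pos hm]
  calc _ ≤ |A.va2 F t| / A.m * ((|C| + A.cbar) * ‖A.va F t‖) := by gcongr
    _ = _ := by ring

/-- By construction `j̄` is orthogonal to the air-velocity, so `v_{a,2}` only sees the attitude
error `j - j̄`. -/
theorem abs_va2_le : |A.va2 F t| ≤ ‖A.va F t‖ * ‖F.j t - jbar A α G vs hs F t‖ := by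
  have : A.va2 F t = ⟪A.va F t, F.j t - jbar A α G vs hs F t⟫ := by
    rw [inner_sub_right, inner_va_jbar, sub_zero, Aircraft.va2]
  rw [this]
  exact abs_real_inner_le_norm _ _

variable (A) in
theorem exists_norm_va_le (hvs : IsDesiredSpeed vs) :
    ∃ K, 0 ≤ K ∧ ∀ t ≥ 0, ‖F.v t‖ ≤ |F.ev vs t| + K ∧ ‖A.va F t‖ ≤ |F.ev vs t| + K := by
  obtain ⟨B, hB⟩ := hvs.bound
  obtain ⟨W, hW⟩ := A.vw_bound
  have hB0 : 0 < B := (hvs.pos 0 le_rfl).trans_le (hB 0 le_rfl)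
  have hW0 : 0 ≤ W := (norm_nonneg _).trans (hW 0 le_rfl)
  refine ⟨B + W, by positivity, fun t ht => ?_⟩
  have h1 : ‖F.v t‖ ≤ |F.ev vs t| + B := by
    have := le_abs_self (F.ev vs t)
    rw [Flight.ev] at this ⊢
    linarith [hB t ht]
  have h2 := norm_sub_le (F.v t) (A.vw t)
  have h3 := hW t ht
  rw [Aircraft.va]
  constructor <;> linarith

theorem inner_i_h_ne_zero (hδ : 0 < δ) (h : δ ≤ |⟪F.i t, F.v t⟫|) (hv : 0 < ‖F.v t‖) :
    ⟪F.i t, F.h t⟫ ≠ 0 := by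
  rw [Flight.h, real_inner_smul_right]
  exact mul_ne_zero (one_div_pos.2 hv).ne' (abs_pos.1 (hδ.trans_le h))

/-- Convergence of the speed, and of what depends on the lateral air-speed. -/
theorem IsClosedLoop.speed_tracking (hF : IsClosedLoop A α G vs hs F)
    (hα : IsSaturationFamily α) (hvs : IsDesiredSpeed vs) (hδ : 0 < δ)
    (h_speed : ∀ t ≥ 0, δ ≤ ‖F.v t‖) (h_thrust : ∀ t ≥ 0, δ ≤ |⟪F.i t, F.v t⟫|)
    (hva : ∀ t ≥ 0, A.va F t ≠ 0)
    (hj : TendsToZeroUltExp (fun t => F.j t - jbar A α G vs hs F t)) :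
    (∃ B, ∀ᶠ t in atTop, ‖F.v t‖ ≤ B ∧ ‖A.va F t‖ ≤ B) ∧
      TendsToZeroUltExp (F.ev vs) ∧ TendsToZeroUltExp (A.va2 F) ∧
      TendsToZeroUltExp (lateralAccel A F) ∧
      TendsToZeroUltExp (fun t => ⟪F.h t, F.a t⟫ - ddt vs t) := by
  have hv0 : ∀ t ≥ 0, 0 < ‖F.v t‖ := fun t ht => hδ.trans_le (h_speed t ht)
  have hih : ∀ t ≥ 0, ⟪F.i t, F.h t⟫ ≠ 0 := fun t ht =>
    inner_i_h_ne_zero hδ (h_thrust t ht) (hv0 t ht)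
  obtain ⟨C, hC, hCw⟩ := hF.norm_lateralAccel_le
  obtain ⟨K, hK, hKv⟩ := exists_norm_va_le (F := F) A hvs
  obtain ⟨M, hM, hIM⟩ := hF.speedIntegrator_bounded hα
  set d : ℝ → ℝ := fun t => ⟪F.h t, lateralAccel A F t⟫ with hd
  set a : ℝ → ℝ := fun t => α G.ΔI |F.I t + F.ev vs t / G.kT3| with ha
  have ha0 : ∀ t, 0 < a t := fun t => hα.pos _ G.ΔI_pos _ (abs_nonneg _)
  have ha1 : ∀ t, a t ≤ 1 := fun t => hα.le_one G.ΔI_pos (abs_nonneg _)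
  have hdw : ∀ t ≥ 0, |d t| ≤ ‖lateralAccel A F t‖ := fun t ht => by
    simpa [Flight.norm_h (hv0 t ht)] using abs_real_inner_le_norm (F.h t) (lateralAccel A F t)
  have hev : ∀ t > 0, HasDerivAt (F.ev vs) (-G.kT1 (F.ev vs t) * F.ev vs t
      - G.kT2 (F.ev vs t) * a t * F.I t + d t) t := fun t ht =>
    hF.hasDerivAt_speedError hvs ht (norm_pos_iff.1 (hv0 t ht.le)) (hih t ht.le)
  -- The decay of `v_{a,2}` needs a bounded air-velocity, which is not yet known. At this stage only
  -- `|v_{a,2}| ≤ |v_a|` is used, which makes the perturbation quadratic.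
  obtain ⟨R, hR, heR⟩ := speedError_bounded G (e := F.ev vs) (b := fun t => a t * F.I t) (d := d)
    (M := M) hC hK
    (by
      filter_upwards [eventually_gt_atTop 0] with t ht
      exact (hev t ht).congr_deriv (by ring))
    (by
      filter_upwards [hIM] with t ht
      rw [abs_mul, abs_of_pos (ha0 t)]
      exact (mul_le_of_le_one_left (abs_nonneg _) (ha1 t)).trans ht)
    (by
      filter_upwards [eventually_ge_atTop 0] with t ht
      refine (hdw t ht).trans ((hCw t ht (hva t ht)).trans ?_)
      have h1 : |A.va2 F t| ≤ ‖A.va F t‖ := by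
        simpa [Aircraft.va2, (hF.body_frame t ht).norm_snd] using abs_real_inner_le_norm (A.va F t) (F.j t)
      have h2 := (hKv t ht).2
      have h3 : ‖A.va F t‖ * |A.va2 F t| ≤ (|F.ev vs t| + K) ^ 2 := by
        rw [pow_two]
        exact mul_le_mul h2 (h1.trans h2) (abs_nonneg _) (by positivity)
      exact mul_le_mul_of_nonneg_left h3 hC)
  have hB : ∀ᶠ t in atTop, ‖F.v t‖ ≤ R + K ∧ ‖A.va F t‖ ≤ R + K := by
    filter_upwards [heR, eventually_ge_atTop 0] with t h1 ht
    have := hKv t ht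
    constructor <;> linarith
  have hva2 : TendsToZeroUltExp (A.va2 F) := by
    refine hj.of_le (R + K) ?_
    filter_upwards [hB] with t h1
    rw [Real.norm_eq_abs]
    refine (abs_va2_le (α := α) (G := G) (vs := vs) (hs := hs)).trans ?_
    gcongr
    exact h1.2
  have hw : TendsToZeroUltExp (lateralAccel A F) := by
    refine hva2.of_le (C * (R + K)) ?_
    filter_upwards [hB, eventually_ge_atTop 0] with t h1 ht
    refine (hCw t ht (hva t ht)).trans ?_
    rw [Real.norm_eq_abs, mul_assoc]
    gcongr
    exact h1.2
  have hdexp : TendsToZeroUltExp d := by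
    refine hw.of_le 1 ?_
    filter_upwards [eventually_ge_atTop 0] with t ht
    rw [one_mul]
    exact hdw t ht
  obtain ⟨r₁, r₂, hr₁, hr⟩ := G.kT2_ratio
  have hr₂ : 0 < r₂ := hr₁.trans_le ((hr 0).1.trans (hr 0).2)
  have hk11 := G.kT11_pos
  have hk12 := G.kT12_pos
  set k := G.kT11 + G.kT12 * R ^ G.pT with hk
  have hk0 : 0 ≤ k := by positivity
  have hk1 : ∀ᶠ t in atTop, G.kT11 ≤ G.kT1 (F.ev vs t) ∧ G.kT1 (F.ev vs t) ≤ k := by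
    filter_upwards [heR] with t h1
    have h2 : |F.ev vs t| ^ G.pT ≤ R ^ G.pT :=
      Real.rpow_le_rpow (abs_nonneg _) h1 (by linarith [G.one_lt_pT])
    have h3 : 0 ≤ G.kT12 * |F.ev vs t| ^ G.pT := by positivity
    have h4 := mul_le_mul_of_nonneg_left h2 hk12.le
    rw [Gains.kT1]
    constructor <;> linarith
  have hk2 : ∀ᶠ t in atTop, G.kT11 / r₂ ≤ G.kT2 (F.ev vs t) ∧ G.kT2 (F.ev vs t) ≤ k / r₁ := by
    filter_upwards [hk1] with t h1
    have h2 := (le_div_iff₀ (G.kT2_pos _)).1 (hr (F.ev vs t)).1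
    have h3 := (div_le_iff₀ (G.kT2_pos _)).1 (hr (F.ev vs t)).2
    rw [Gains.kT1] at h1
    rw [div_le_iff₀ hr₂, le_div_iff₀ hr₁]
    constructor <;> linarith
  have hkT3 := G.kT3_pos
  set α₀ := α G.ΔI (M + R / G.kT3) with hα₀
  have hα₀0 : 0 < α₀ := hα.pos _ G.ΔI_pos _ (by positivity)
  have halow : ∀ᶠ t in atTop, α₀ ≤ a t := by
    filter_upwards [heR, hIM] with t h1 h2
    refine hα.le_of_le G.ΔI_pos (abs_nonneg _) ((abs_add_le _ _).trans ?_)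
    rw [abs_div, abs_of_pos hkT3]
    gcongr
  set κ := min (min G.kT11 (G.kT11 / r₂)) α₀ with hκ
  have hκ1 : κ ≤ G.kT11 := (min_le_left _ _).trans (min_le_left _ _)
  have hκ2 : κ ≤ G.kT11 / r₂ := (min_le_left _ _).trans (min_le_right _ _)
  have hκ3 : κ ≤ α₀ := min_le_right _ _
  obtain ⟨he, hI⟩ := speed_loop (e := F.ev vs) (I := F.I) (k₁ := fun t => G.kT1 (F.ev vs t))
    (k₂ := fun t => G.kT2 (F.ev vs t)) (a := a) (d := d) (κ := κ) (K := max k (k / r₁))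
    (k₃ := G.kT3) (M := max M R) (by positivity) hkT3
    (by filter_upwards [eventually_gt_atTop 0] with t ht using hev t ht)
    (by
      filter_upwards [eventually_gt_atTop 0] with t ht
      refine ((hF.speed_integrator t ht.le).hasDerivAt (Ici_mem_nhds ht)).congr_deriv ?_
      rw [Irate, sat, smul_eq_mul, Real.norm_eq_abs]
      simp only [ha]
      field_simp
      ring)
    (by
      filter_upwards [hk1] with t h1
      exact ⟨hκ1.trans h1.1, h1.2.trans (le_max_left _ _)⟩)
    (by
      filter_upwards [hk2] with t h1
      exact ⟨hκ2.trans h1.1, h1.2.trans (le_max_right _ _)⟩)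
    (by
      filter_upwards [halow] with t h1
      exact ⟨hκ3.trans h1, ha1 t⟩)
    (by filter_upwards [heR] with t h1 using h1.trans (le_max_right _ _))
    (by filter_upwards [hIM] with t h1 using h1.trans (le_max_left _ _)) hdexp
  refine ⟨⟨R + K, hB⟩, he, hva2, hw, ?_⟩
  have h1 : TendsToZeroUltExp (fun t => G.kT1 (F.ev vs t) * F.ev vs t) := by
    refine he.of_le k ?_
    filter_upwards [hk1] with t h1
    rw [norm_mul, Real.norm_eq_abs, abs_of_nonneg (hk11.le.trans h1.1)]
    gcongr
    exact h1.2
  have h2 : TendsToZeroUltExp (fun t => G.kT2 (F.ev vs t) * a t * F.I t) := by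
    refine hI.of_le (k / r₁) ?_
    filter_upwards [hk2] with t h1
    have := G.kT2_pos (F.ev vs t)
    rw [norm_mul, Real.norm_eq_abs, abs_of_pos (mul_pos this (ha0 t))]
    gcongr
    exact (mul_le_of_le_one_right this.le (ha1 t)).trans h1.2
  refine ((h1.neg.sub h2).add hdexp).congr' ?_
  filter_upwards [eventually_ge_atTop 0] with t ht
  rw [hF.inner_heading_acceleration ht (hih t ht)]
  ring

/-- The acceleration converges to the desired acceleration. -/
theorem IsClosedLoop.acceleration_tracking (hF : IsClosedLoop A α G vs hs F)
    (hvs : IsDesiredSpeed vs) {B : ℝ} (hδ : 0 < δ) (h_speed : ∀ t ≥ 0, δ ≤ ‖F.v t‖)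
    (h_thrust : ∀ t ≥ 0, δ ≤ |⟪F.i t, F.v t⟫|)
    (h_astar : ∀ t ≥ 0, δ ≤ ‖astar α G vs hs F t - A.gbar F t‖)
    (hB : ∀ᶠ t in atTop, ‖F.v t‖ ≤ B ∧ ‖A.va F t‖ ≤ B)
    (hi : TendsToZeroUltExp (fun t => F.i t - ibar A α G vs hs F t))
    (hw : TendsToZeroUltExp (lateralAccel A F))
    (he : TendsToZeroUltExp (fun t => ⟪F.h t, F.a t⟫ - ddt vs t)) :
    TendsToZeroUltExp (fun t => F.a t - astar α G vs hs F t) := by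
  have hv0 : ∀ t ≥ 0, 0 < ‖F.v t‖ := fun t ht => hδ.trans_le (h_speed t ht)
  have hB0 : 0 < B := by
    obtain ⟨t, h1, h2⟩ := (hB.and (eventually_ge_atTop 0)).exists
    exact (hv0 t h2).trans_le h1.1
  set lam : ℝ → ℝ := fun t => ‖astar α G vs hs F t - A.gbar F t‖ with hlam
  have hlam0 : ∀ t, 0 ≤ lam t := fun t => norm_nonneg _
  -- Eventual lower bound for `|h · i|`, from `|i · v| ≥ δ` and `|v| ≤ B`.
  set c := δ / B with hc
  have hc0 : 0 < c := by positivity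
  have hhi : ∀ᶠ t in atTop, c ≤ |⟪F.h t, F.i t⟫| := by
    filter_upwards [hB, eventually_ge_atTop 0] with t h1 ht
    rw [Flight.h, real_inner_smul_left, abs_mul, abs_of_pos (one_div_pos.2 (hv0 t ht)),
      one_div_mul_eq_div, real_inner_comm, hc]
    have := hv0 t ht
    have := h_thrust t ht
    gcongr
    exact h1.1
  have has : ∀ t ≥ 0, astar α G vs hs F t = A.gbar F t + lam t • ibar A α G vs hs F t := by
    intro t ht
    have h1 : 0 < ‖astar α G vs hs F t - A.gbar F t‖ := hδ.trans_le (h_astar t ht)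
    rw [ibar, smul_smul, mul_one_div_cancel h1.ne', one_smul]
    abel
  have hhas : ∀ t ≥ 0, ⟪F.h t, astar α G vs hs F t⟫ = ddt vs t := by
    intro t ht
    rw [astar, inner_add_right, real_inner_smul_right, real_inner_smul_right,
      real_inner_self_eq_norm_sq, Flight.norm_h (hv0 t ht), real_inner_comm,
      inner_cross_self_right]
    ring
  obtain ⟨D, hD⟩ := hvs.deriv_bound
  have hm := A.m_pos
  have hcb := A.cbar_pos
  -- The angular velocity of `h*` is not assumed bounded, so the formula for `a*` gives no bound.
  -- Instead, `a* = ḡ + lam ī` is projected on `h`: this gives `lam (h · ī) = v̇* - h · ḡ`, and `|h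
  -- · ī| ≥ c / 2` eventually.
  set Λ := 2 / c * (D + (‖A.g‖ + A.cbar / A.m * B * B)) with hΛ
  have hlamle : ∀ᶠ t in atTop, lam t ≤ Λ := by
    filter_upwards [hB, hhi, hi.eventually_norm_le (half_pos hc0), eventually_ge_atTop 0] with
      t h1 h2 h3 ht
    have e1 : lam t * ⟪F.h t, ibar A α G vs hs F t⟫ = ddt vs t - ⟪F.h t, A.gbar F t⟫ := by
      rw [← hhas t ht, has t ht, inner_add_right, real_inner_smul_right]
      ring
    have e2 : |⟪F.h t, A.gbar F t⟫| ≤ ‖A.g‖ + A.cbar / A.m * B * B := by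
      have h4 := abs_real_inner_le_norm (F.h t) (A.gbar F t)
      rw [Flight.norm_h (hv0 t ht), one_mul] at h4
      refine h4.trans ((norm_sub_le _ _).trans ?_)
      rw [norm_smul, Real.norm_eq_abs, abs_of_nonneg (by positivity)]
      have := h1.2
      gcongr
    have e3 : c / 2 ≤ |⟪F.h t, ibar A α G vs hs F t⟫| := by
      have h4 := abs_real_inner_le_norm (F.h t) (F.i t - ibar A α G vs hs F t)
      rw [Flight.norm_h (hv0 t ht), one_mul, inner_sub_right] at h4
      have := abs_sub_abs_le_abs_sub ⟪F.h t, F.i t⟫ ⟪F.h t, ibar A α G vs hs F t⟫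
      linarith
    have e4 : lam t * (c / 2) ≤ D + (‖A.g‖ + A.cbar / A.m * B * B) := by
      calc lam t * (c / 2) ≤ lam t * |⟪F.h t, ibar A α G vs hs F t⟫| := by
            gcongr
        _ = |ddt vs t - ⟪F.h t, A.gbar F t⟫| := by
            rw [← e1, abs_mul, abs_of_nonneg (hlam0 t)]
        _ ≤ _ := (abs_sub _ _).trans (add_le_add (hD t ht) e2)
    rw [hΛ, div_mul_eq_mul_div, le_div_iff₀ hc0]
    linarith
  have hlami : TendsToZeroUltExp (fun t => lam t • (F.i t - ibar A α G vs hs F t)) := by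
    refine hi.of_le Λ ?_
    filter_upwards [hlamle] with t h1
    rw [norm_smul, Real.norm_eq_abs, abs_of_nonneg (hlam0 t)]
    gcongr
  -- Along `h`, both accelerations have the component `v̇*` up to decaying terms; dividing by `h ·
  -- i` compares the thrust intensity with `lam`.
  have hτ : TendsToZeroUltExp (fun t => Tbar A α G vs F t / A.m - lam t) := by
    refine ((he.norm.add hw.norm).add hlami.norm).of_le (1 / c) ?_
    filter_upwards [hhi, eventually_ge_atTop 0] with t h1 ht
    have e1 : (Tbar A α G vs F t / A.m - lam t) * ⟪F.h t, F.i t⟫ =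
        (⟪F.h t, F.a t⟫ - ddt vs t) - ⟪F.h t, lateralAccel A F t⟫
          - ⟪F.h t, lam t • (F.i t - ibar A α G vs hs F t)⟫ := by
      rw [← hhas t ht, has t ht, hF.acceleration_eq ht]
      simp only [inner_add_right, inner_sub_right, real_inner_smul_right]
      ring
    have e2 : ∀ x : E3, |⟪F.h t, x⟫| ≤ ‖x‖ := fun x => by
      simpa [Flight.norm_h (hv0 t ht)] using abs_real_inner_le_norm (F.h t) x
    have e3 : |Tbar A α G vs F t / A.m - lam t| * c ≤ ‖⟪F.h t, F.a t⟫ - ddt vs t‖ +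
        ‖lateralAccel A F t‖ + ‖lam t • (F.i t - ibar A α G vs hs F t)‖ := by
      calc _ ≤ |Tbar A α G vs F t / A.m - lam t| * |⟪F.h t, F.i t⟫| := by gcongr
        _ = _ := by rw [← abs_mul, e1]
        _ ≤ _ := (abs_sub _ _).trans (add_le_add ((abs_sub _ _).trans
            (add_le_add le_rfl (e2 _))) (e2 _))
    rw [Real.norm_eq_abs, one_div_mul_eq_div, le_div_iff₀ hc0]
    exact e3.trans (Real.le_norm_self _)
  have hτi : TendsToZeroUltExp (fun t => (Tbar A α G vs F t / A.m - lam t) • F.i t) := by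
    refine hτ.of_le 1 ?_
    filter_upwards [eventually_ge_atTop 0] with t ht
    rw [norm_smul, (hF.body_frame t ht).norm_fst, mul_one, one_mul]
  refine ((hτi.add hlami).add hw).congr' ?_
  filter_upwards [eventually_ge_atTop 0] with t ht
  rw [has t ht, hF.acceleration_eq ht]
  module

/-- Asymptotic behaviour of the heading. -/
theorem IsClosedLoop.heading_tracking (hF : IsClosedLoop A α G vs hs F)
    (hα : IsSaturationFamily α) (hδ : 0 < δ) (h_speed : ∀ t ≥ 0, δ ≤ ‖F.v t‖)
    (ha : TendsToZeroUltExp (fun t => F.a t - astar α G vs hs F t)) :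
    (Tendsto (fun t => F.h t + hs t) atTop (𝓝 0) ∧ Tendsto F.z atTop (𝓝 0)) ∨
      (TendsToZeroUltExp (fun t => F.h t - hs t) ∧ TendsToZeroUltExp F.z) := by
  have hv0 : ∀ t ≥ 0, 0 < ‖F.v t‖ := fun t ht => hδ.trans_le (h_speed t ht)
  have hh : ∀ t ≥ 0, ‖F.h t‖ = 1 := fun t ht => Flight.norm_h (hv0 t ht)
  set D : ℝ → E3 := fun t => F.a t - astar α G vs hs F t with hD
  -- Differentiating `v / |v|` keeps only the part of the acceleration normal to `h`, divided by
  -- `|v|`. For `a*` this is exactly `ω̄_h × h`; the acceleration error gives `ε`.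
  refine heading_loop hα G.Δz_pos G.kh1_pos G.kh2_pos G.kz_pos (h := F.h) (hs := hs) (z := F.z)
    (ω := omegaHs hs) (ε := fun t => (1 / ‖F.v t‖) • (D t - ⟪F.h t, D t⟫ • F.h t))
    hh hF.norm_heading ?_ ?_ ?_ hF.heading_integrator_init
    (fun t ht => (hF.heading_integrator t ht).continuousWithinAt)
    hF.heading_differentiable.continuousOn ?_
  · filter_upwards [eventually_gt_atTop 0] with t ht
    have hvt := hv0 t ht.le
    refine (hasDerivAt_normalize (hF.hasDerivAt_v ht) (norm_pos_iff.1 hvt)).congr_deriv ?_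
    change (1 / ‖F.v t‖) • (F.a t - ⟪F.h t, F.a t⟫ • F.h t) =
      cross (omegaHbar α G hs F t) (F.h t) + _
    have e1 : F.a t = astar α G vs hs F t + D t := by simp only [hD]; abel
    have e2 : ⟪F.h t, F.a t⟫ = ddt vs t + ⟪F.h t, D t⟫ := by
      rw [e1, inner_add_right, astar, inner_add_right, real_inner_smul_right,
        real_inner_smul_right, real_inner_self_eq_norm_sq, hh t ht.le,
        real_inner_comm _ (F.h t), inner_cross_self_right]
      ring
    rw [e2, e1, astar]
    match_scalars <;> field_simp
    ring
  · intro t ht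
    have hd := hasDerivAt_of_differentiableOn hF.heading_differentiable ht
    refine hd.congr_deriv ?_
    rw [omegaHs, cross_cross, real_inner_comm, real_inner_comm (hs t) (ddt hs t),
      inner_deriv_eq_zero_of_unit ht hd hF.norm_heading, real_inner_self_eq_norm_sq,
      hF.norm_heading t ht.le]
    simp
  · intro t ht
    exact (hF.heading_integrator t ht.le).hasDerivAt (Ici_mem_nhds ht)
  · refine ha.of_le (1 / δ * 2) ?_
    filter_upwards [eventually_ge_atTop 0] with t ht
    have hvt := hv0 t ht
    have e1 : ‖D t - ⟪F.h t, D t⟫ • F.h t‖ ≤ 2 * ‖D t‖ := by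
      refine (norm_sub_le _ _).trans ?_
      have := abs_real_inner_le_norm (F.h t) (D t)
      rw [hh t ht, one_mul] at this
      rw [norm_smul, hh t ht, mul_one, Real.norm_eq_abs]
      linarith
    rw [norm_smul, Real.norm_eq_abs, abs_of_pos (one_div_pos.2 hvt), mul_assoc]
    have := h_speed t ht
    gcongr

end ClosedLoop

end PathFollowing

/-! ### Assembly of the cascade. -/

open PathFollowing

theorem theorem1
    (A : Aircraft) (α : ℝ → ℝ → ℝ) (hα : IsSaturationFamily α) (G : Gains)
    (vs : ℝ → ℝ) (hvs : IsDesiredSpeed vs) (hs : ℝ → E3) (F : Flight)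
    (hF : IsClosedLoop A α G vs hs F)
    (P : Path) (s : ℝ → ℝ) (hproj : IsProjection P F s)
    (δ : ℝ) (hδ : 0 < δ)
    (h_cond : ∀ t ≥ 0, δ ≤ conditioning P F s t)
    (h_speed : ∀ t ≥ 0, δ ≤ ‖F.v t‖)
    (h_acc : ∀ t ≥ 0, δ ≤ ‖F.a t - A.gbar F t‖)
    (h_astar : ∀ t ≥ 0, δ ≤ ‖astar α G vs hs F t - A.gbar F t‖)
    (h_heading_acc : ∀ t ≥ 0, δ ≤ |⟪F.h t, F.a t - A.gbar F t⟫|)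
    (h_air : ∀ t ≥ 0, δ ≤ ‖cross (ibar A α G vs hs F t) (A.va F t)‖)
    (h_thrust : ∀ t ≥ 0, δ ≤ |⟪F.i t, F.v t⟫|)
    (h_angle : frameAngle A α G vs hs F 0 ≠ Real.pi) :
    -- the speed converges to the desired speed
    TendsToZeroUltExp (fun t => ‖F.v t‖ - vs t) ∧
    -- the body frame converges to the desired frame
    TendsToZeroUltExp (fun t => F.i t - ibar A α G vs hs F t) ∧
    TendsToZeroUltExp (fun t => F.j t - jbar A α G vs hs F t) ∧
    TendsToZeroUltExp (fun t => F.k t - kbar A α G vs hs F t) ∧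
    -- the lateral air-speed converges to zero, and so does the sideslip angle, as long as
    -- its denominator stays away from zero
    TendsToZeroUltExp (fun t => A.va2 F t) ∧
    ((∃ η > 0, ∀ᶠ t in atTop, η ≤ |A.va1 F t|) →
      TendsToZeroUltExp (fun t => A.sideslip F t)) ∧
    -- if `(h, z)` does not converge to `(-h*, 0)`, it converges to `(h*, 0)`
    (¬ (Tendsto (fun t => F.h t + hs t) atTop (𝓝 0) ∧ Tendsto F.z atTop (𝓝 0)) →
      TendsToZeroUltExp (fun t => F.h t - hs t) ∧
      TendsToZeroUltExp F.z ∧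
      -- in this case, with the heading given by the guidance law, the path is followed
      ∀ Q : GuidanceParams, (∀ t ≥ 0, hs t = guidanceHeading P F s t α Q) →
        TendsToZeroUltExp (fun t => ptilde P F s t) ∧
        TendsToZeroUltExp (fun t => F.h t - Q.σ • P.u (s t))) := by
  have hv0 : ∀ t ≥ 0, 0 < ‖F.v t‖ := fun t ht => hδ.trans_le (h_speed t ht)
  have hva : ∀ t ≥ 0, A.va F t ≠ 0 := by
    intro t ht h0
    have h1 := (h_air t ht).trans (norm_cross_le _ _)
    rw [h0, norm_zero, mul_zero] at h1
    linarith
  have hfr : ∀ t ≥ 0, IsDirectFrame (ibar A α G vs hs F t) (jbar A α G vs hs F t)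
      (kbar A α G vs hs F t) := fun t ht =>
    isDirectFrame_desired (hδ.trans_le (h_astar t ht)) (hδ.trans_le (h_air t ht))
  obtain ⟨hi, hj, hk⟩ := hF.attitude_tracking hfr h_angle
  obtain ⟨⟨B, hB⟩, he, hva2, hw, hacc⟩ :=
    hF.speed_tracking hα hvs hδ h_speed h_thrust hva hj
  have ha := hF.acceleration_tracking hvs hδ h_speed h_thrust h_astar hB hi hw hacc
  refine ⟨he, hi, hj, hk, hva2, ?_, fun hnot => ?_⟩
  · rintro ⟨η, hη, hηva⟩
    refine hva2.of_le (1 / η) ?_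
    filter_upwards [hηva] with t ht
    have h1 : |Real.arctan (A.va2 F t / A.va1 F t)| ≤ |A.va2 F t / A.va1 F t| :=
      abs_arctan_le _
    rw [Aircraft.sideslip, Real.norm_eq_abs, Real.norm_eq_abs]
    refine h1.trans ?_
    rw [abs_div, one_div_mul_eq_div]
    gcongr
  · obtain ⟨hh, hz⟩ := (hF.heading_tracking hα hδ h_speed ha).resolve_left hnot
    refine ⟨hh, hz, fun Q hQ => hproj.path_following hα
      (fun t ht => (hF.position t ht.le).hasDerivAt (Ici_mem_nhds ht)) hδ h_speed
      (hB.mono fun t ht => ht.1) (hh.congr' ?_)⟩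
    filter_upwards [eventually_ge_atTop 0] with t ht
    rw [hQ t ht]
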